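/- Let $X$ be a topological space and let $\mathcal S^\cdot=(\mathcal S^0\to\mathcal S^1\to\cdots)$ be a non-negative complex of sheaves of abelian groups on $X$. For an open covering $\mathcal U$ of $X$ let $\mathbb H^k(\mathcal U,\mathcal S^\cdot)$ be the $k$-th cohomology group of the total complex of the Čech double complex $C^p(\mathcal U,\mathcal S^q)=\prod_{i_0,\dots,i_p}\mathcal S^q(U_{i_0}\cap\dots\cap U_{i_p})$, and let $$\check{\mathbb H}^k(X,\mathcal S^\cdot)=\varinjlim_{\mathcal U}\mathbb H^k(\mathcal U,\mathcal S^\cdot)$$ be the Čech hypercohomology, the direct limit being taken over all open coverings of $X$, ordered by refinement. Let $\mathbb H^k(X,\mathcal S^\cdot)=H^k(\Gamma(X,\mathcal I^\cdot))$ be the derived hypercohomology, where $\mathcal S^\cdot\to\mathcal I^\cdot$ is a quasi-isomorphism to a non-negative complex of injective abelian sheaves. For every $\mathcal U$ restriction of sections induces an isomorphism $H^k(\Gamma(X,\mathcal I^\cdot))\cong\mathbb H^k(\mathcal U,\mathcal I^\cdot)$, and the maps $\mathbb H^k(\mathcal U,\mathcal S^\cdot)\to\mathbb H^k(\mathcal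 U,\mathcal I^\cdot)\cong H^k(\Gamma(X,\mathcal I^\cdot))$ induce in the limit the natural homomorphism $$\check{\mathbb H}^k(X,\mathcal S^\cdot)\to\mathbb H^k(X,\mathcal S^\cdot).$$ This homomorphism is bijective for $k\le 1$ and injective for $k=2$. -/

import Mathlib

open CategoryTheory TopologicalSpace Opposite Limits

universe u

noncomputable section

namespace CechHyper

/-- A first-quadrant double complex of abelian groups, with commuting differentials. -/
structure DoubleComplex where
  X : ℕ → ℕ → AddCommGrpCat.{u}
  δ (p q : ℕ) : X p q ⟶ X (p + 1) q
  d (p q : ℕ) : X p q ⟶ X p (q + 1)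
  δ_δ (p q : ℕ) : δ p q ≫ δ (p + 1) q = 0
  d_d (p q : ℕ) : d p q ≫ d p (q + 1) = 0
  comm (p q : ℕ) : δ p q ≫ d (p + 1) q = d p q ≫ δ p (q + 1)

namespace DoubleComplex

/-- Morphisms of double complexes. -/
@[ext]
structure Hom (K L : DoubleComplex.{u}) where
  f (p q : ℕ) : K.X p q ⟶ L.X p q
  comm_δ (p q : ℕ) : f p q ≫ L.δ p q = K.δ p q ≫ f (p + 1) q
  comm_d (p q : ℕ) : f p q ≫ L.d p q = K.d p q ≫ f p (q + 1)

instance : Category DoubleComplex.{u} where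
  Hom K L := Hom K L
  id K := { f := fun _ _ => 𝟙 _, comm_δ := by simp, comm_d := by simp }
  comp φ ψ :=
    { f := fun p q => φ.f p q ≫ ψ.f p q
      comm_δ := fun p q => by
        rw [Category.assoc, ψ.comm_δ, ← Category.assoc, φ.comm_δ, Category.assoc]
      comm_d := fun p q => by
        rw [Category.assoc, ψ.comm_d, ← Category.assoc, φ.comm_d, Category.assoc] }
  id_comp _ := Hom.ext (by funext p q; exact Category.id_comp _)
  comp_id _ := Hom.ext (by funext p q; exact Category.comp_id _)
  assoc _ _ _ := Hom.ext (by funext p q; exact Category.assoc _ _ _)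

variable (K : DoubleComplex.{u})

/-- The degree `n` part `⨁_{p + q = n} K^{p,q}` of the total complex: an element `z` has the
components `z ⟨(p, q), h⟩`, for `h : p + q = n`. -/
abbrev Tot (n : ℕ) : Type u := ∀ a : {a : ℕ × ℕ // a.1 + a.2 = n}, K.X a.1.1 a.1.2

/-- The `δ`-part of the total differential. -/
def totδ {n : ℕ} (z : K.Tot n) : K.Tot (n + 1)
  | ⟨(0, _), _⟩ => 0
  | ⟨(p + 1, q), h⟩ => K.δ p q (z ⟨(p, q), by dsimp only at h ⊢; omega⟩)

/-- The `d`-part of the total differential, with sign `(-1)^p`. -/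
def totd {n : ℕ} (z : K.Tot n) : K.Tot (n + 1)
  | ⟨(_, 0), _⟩ => 0
  | ⟨(p, q + 1), h⟩ => ((-1 : ℤ) ^ p) • K.d p q (z ⟨(p, q), by dsimp only at h ⊢; omega⟩)

/-- The total differential `D = δ + (-1)^p d`. -/
def totD (n : ℕ) : K.Tot n →+ K.Tot (n + 1) where
  toFun z := K.totδ z + K.totd z
  map_zero' := by
    funext ⟨⟨p, q⟩, h⟩
    rcases p with _ | p <;> rcases q with _ | q <;> simp [totδ, totd]
  map_add' z w := by
    funext ⟨⟨p, q⟩, h⟩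
    rcases p with _ | p <;> rcases q with _ | q <;> (simp [totδ, totd]; try abel)

lemma totD_apply {n : ℕ} (z : K.Tot n) (a) :
    K.totD n z a = K.totδ z a + K.totd z a := rfl

lemma δ_δ_apply (p q : ℕ) (x : K.X p q) : K.δ (p + 1) q (K.δ p q x) = 0 := by
  rw [← ConcreteCategory.comp_apply, K.δ_δ]; rfl

lemma d_d_apply (p q : ℕ) (x : K.X p q) : K.d p (q + 1) (K.d p q x) = 0 := by
  rw [← ConcreteCategory.comp_apply, K.d_d]; rfl

lemma comm_apply (p q : ℕ) (x : K.X p q) :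
    K.d (p + 1) q (K.δ p q x) = K.δ p (q + 1) (K.d p q x) := by
  rw [← ConcreteCategory.comp_apply, K.comm, ConcreteCategory.comp_apply]

lemma totD_totD {n : ℕ} (z : K.Tot n) : K.totD (n + 1) (K.totD n z) = 0 := by
  funext ⟨⟨p, q⟩, h⟩
  rcases p with _ | _ | p <;> rcases q with _ | _ | q <;>
    simp [totD_apply, totδ, totd, δ_δ_apply, d_d_apply, comm_apply, pow_succ]

/-- The total complex of a double complex. -/
def total : CochainComplex AddCommGrpCat.{u} ℕ :=
  CochainComplex.of (fun n => AddCommGrpCat.of (K.Tot n)) (fun n => AddCommGrpCat.ofHom (K.totD n))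
    (fun n => by
      ext z : 2
      exact K.totD_totD z)

lemma total_d (n : ℕ) : K.total.d n (n + 1) = AddCommGrpCat.ofHom (K.totD n) :=
  CochainComplex.of_d (fun n => AddCommGrpCat.of (K.Tot n))
    (fun n => AddCommGrpCat.ofHom (K.totD n)) n

/-- The map induced by a morphism of double complexes in degree `n` of the total complexes. -/
def totMap {K L : DoubleComplex.{u}} (φ : K ⟶ L) (n : ℕ) : K.Tot n →+ L.Tot n where
  toFun z a := φ.f a.1.1 a.1.2 (z a)
  map_zero' := by funext a; exact map_zero _
  map_add' z w := by funext a; exact map_add _ _ _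

lemma totD_totMap {K L : DoubleComplex.{u}} (φ : K ⟶ L) (n : ℕ) (z : K.Tot n) :
    L.totD n (totMap φ n z) = totMap φ (n + 1) (K.totD n z) := by
  funext ⟨⟨p, q⟩, h⟩
  have h1 := fun p q (x : K.X p q) => ConcreteCategory.congr_hom (φ.comm_δ p q) x
  have h2 := fun p q (x : K.X p q) => ConcreteCategory.congr_hom (φ.comm_d p q) x
  simp only [ConcreteCategory.comp_apply] at h1 h2
  rcases p with _ | p <;> rcases q with _ | q <;>
    simp [totD_apply, totδ, totd, totMap, h1, h2]

/-- The total complex as a functor. -/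
def totalFunctor : DoubleComplex.{u} ⥤ CochainComplex AddCommGrpCat.{u} ℕ where
  obj K := K.total
  map {K L} φ :=
    { f := fun n => AddCommGrpCat.ofHom (totMap φ n)
      comm' := by
        rintro n _ rfl
        rw [total_d, total_d]
        ext z : 2
        exact totD_totMap φ n z }
  map_id K := by
    ext n z
    rfl
  map_comp φ ψ := by
    ext n z
    rfl

end DoubleComplex

/-! ### Čech cochains -/

section Cech

variable {X : TopCat.{u}}

/-- Restriction of sections of an abelian sheaf. -/
def res (F : TopCat.Sheaf AddCommGrpCat.{u} X) {U V : Opens X} (h : V ≤ U) :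
    F.presheaf.obj (op U) →+ F.presheaf.obj (op V) :=
  (F.presheaf.map (homOfLE h).op).hom

lemma res_res (F : TopCat.Sheaf AddCommGrpCat.{u} X) {U V W : Opens X} (h : V ≤ U) (h' : W ≤ V)
    (s : F.presheaf.obj (op U)) : res F h' (res F h s) = res F (h'.trans h) s := by
  exact (ConcreteCategory.congr_hom (F.presheaf.map_comp (homOfLE h).op (homOfLE h').op) s).symm

lemma res_self (F : TopCat.Sheaf AddCommGrpCat.{u} X) {U : Opens X} (h : U ≤ U)
    (s : F.presheaf.obj (op U)) : res F h s = s :=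
  ConcreteCategory.congr_hom (F.presheaf.map_id (op U)) s

/-- The map on sections over `U` induced by a morphism of abelian sheaves. -/
def app {F G : TopCat.Sheaf AddCommGrpCat.{u} X} (φ : F ⟶ G) (U : Opens X) :
    F.presheaf.obj (op U) →+ G.presheaf.obj (op U) :=
  (φ.hom.app (op U)).hom

lemma app_res {F G : TopCat.Sheaf AddCommGrpCat.{u} X} (φ : F ⟶ G) {U V : Opens X} (h : V ≤ U)
    (s : F.presheaf.obj (op U)) : app φ V (res F h s) = res G h (app φ U s) :=
  ConcreteCategory.congr_hom (φ.hom.naturality (homOfLE h).op) s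

variable {ι : Type u} (U : ι → Opens X)

/-- The intersection `U_{i_0} ∩ ⋯ ∩ U_{i_p}`. -/
def inter {p : ℕ} (i : Fin (p + 1) → ι) : Opens X :=
  ⟨⋂ a, (U (i a) : Set X), isOpen_iInter_of_finite fun a => (U (i a)).isOpen⟩

lemma mem_inter {p : ℕ} {i : Fin (p + 1) → ι} {x : X} : x ∈ inter U i ↔ ∀ a, x ∈ U (i a) := by
  change x ∈ ⋂ a, (U (i a) : Set X) ↔ _
  simp

lemma inter_le_comp {p q : ℕ} (i : Fin (q + 1) → ι) (f : Fin (p + 1) → Fin (q + 1)) :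
    inter U i ≤ inter U (i ∘ f) :=
  fun _ hx => (mem_inter U).2 fun a => (mem_inter U).1 hx (f a)

variable (F : TopCat.Sheaf AddCommGrpCat.{u} X)

/-- Čech cochains `C^p(U, F) = ∏_{i_0, …, i_p} F(U_{i_0} ∩ ⋯ ∩ U_{i_p})`. -/
abbrev Cochain (p : ℕ) : Type u := ∀ i : Fin (p + 1) → ι, F.presheaf.obj (op (inter U i))

/-- The Čech coboundary
`(δ s)_{i_0 … i_{p+1}} = ∑_j (-1)^j s_{i_0 … î_j … i_{p+1}}|_{U_{i_0} ∩ ⋯ ∩ U_{i_{p+1}}}`. -/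
def coboundary (p : ℕ) : Cochain U F p →+ Cochain U F (p + 1) where
  toFun s i := ∑ j : Fin (p + 2),
    ((-1 : ℤ) ^ (j : ℕ)) • res F (inter_le_comp U i j.succAbove) (s (i ∘ j.succAbove))
  map_zero' := by
    funext i
    simp
  map_add' s t := by
    funext i
    simp [Finset.sum_add_distrib]

/-- The Čech cochains as a cosimplicial abelian group. -/
def cosimplicial : CosimplicialObject AddCommGrpCat.{u} where
  obj n := AddCommGrpCat.of (Cochain U F n.len)
  map {m n} f := AddCommGrpCat.ofHom
    { toFun := fun s i => res F (inter_le_comp U i f.toOrderHom) (s (i ∘ f.toOrderHom))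
      map_zero' := by funext i; exact map_zero _
      map_add' := fun s t => by funext i; exact map_add _ _ _ }
  map_id n := by
    ext s : 2
    funext i
    exact res_self F _ _
  map_comp f g := by
    ext s : 2
    funext i
    exact (res_res F _ _ _).symm

lemma coboundary_coboundary (p : ℕ) (s : Cochain U F p) :
    coboundary U F (p + 1) (coboundary U F p s) = 0 := by
  have key : ∀ p, AddCommGrpCat.ofHom (coboundary U F p) =
      AlgebraicTopology.AlternatingCofaceMapComplex.objD (cosimplicial U F) p := by
    intro p
    ext s : 2
    funext i
    let ev : ((cosimplicial U F).obj (.mk p) ⟶ (cosimplicial U F).obj (.mk (p + 1))) →+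
        F.presheaf.obj (op (inter U i)) :=
      { toFun := fun f => f.hom s i
        map_zero' := rfl
        map_add' := fun _ _ => rfl }
    change _ = ev _
    rw [AlgebraicTopology.AlternatingCofaceMapComplex.objD, map_sum]
    rfl
  have := AlgebraicTopology.AlternatingCofaceMapComplex.d_squared (cosimplicial U F) p
  rw [← key, ← key] at this
  exact ConcreteCategory.congr_hom this s

/-- The map on Čech cochains induced by a morphism of sheaves. -/
def cochainMap {F G : TopCat.Sheaf AddCommGrpCat.{u} X} (φ : F ⟶ G) (p : ℕ) :
    Cochain U F p →+ Cochain U G p where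
  toFun s i := app φ _ (s i)
  map_zero' := by funext i; exact map_zero _
  map_add' s t := by funext i; exact map_add _ _ _

lemma coboundary_cochainMap {F G : TopCat.Sheaf AddCommGrpCat.{u} X} (φ : F ⟶ G) (p : ℕ)
    (s : Cochain U F p) :
    coboundary U G p (cochainMap U φ p s) = cochainMap U φ (p + 1) (coboundary U F p s) := by
  funext i
  simp [coboundary, cochainMap, app_res]

/-- The Čech double complex `C^p(U, S^q)` of a non-negative complex of abelian sheaves. -/
def cechDouble (S : CochainComplex (TopCat.Sheaf AddCommGrpCat.{u} X) ℕ) : DoubleComplex.{u} where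
  X p q := AddCommGrpCat.of (Cochain U (S.X q) p)
  δ p q := AddCommGrpCat.ofHom (coboundary U (S.X q) p)
  d p q := AddCommGrpCat.ofHom (cochainMap U (S.d q (q + 1)) p)
  δ_δ p q := by
    ext s : 2
    exact coboundary_coboundary U _ p s
  d_d p q := by
    ext s : 2
    funext i
    exact ConcreteCategory.congr_hom (congrArg (fun φ => φ.hom.app (op (inter U i)))
      (S.d_comp_d q (q + 1) (q + 2))) (s i)
  comm p q := by
    ext s : 2
    exact (coboundary_cochainMap U _ p s).symm

/-- Functoriality of the Čech double complex in the complex of sheaves. -/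
def cechDoubleMap {S T : CochainComplex (TopCat.Sheaf AddCommGrpCat.{u} X) ℕ} (φ : S ⟶ T) :
    cechDouble U S ⟶ cechDouble U T where
  f p q := AddCommGrpCat.ofHom (cochainMap U (φ.f q) p)
  comm_δ p q := by
    ext s : 2
    exact coboundary_cochainMap U _ p s
  comm_d p q := by
    ext s : 2
    funext i
    exact ConcreteCategory.congr_hom (congrArg (fun φ => φ.hom.app (op (inter U i)))
      (φ.comm q (q + 1))) (s i)

variable {U} {κ : Type u} {V : κ → Opens X}

lemma inter_le_inter (τ : κ → ι) (hτ : ∀ k, V k ≤ U (τ k)) {p : ℕ} (i : Fin (p + 1) → κ) :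
    inter V i ≤ inter U (τ ∘ i) :=
  fun _ hx => (mem_inter U).2 fun a => hτ _ ((mem_inter V).1 hx a)

/-- The map on Čech double complexes induced by a refinement map `τ`, where `V_k ⊆ U_{τ(k)}`:
`s ↦ (s_{τ(k_0) … τ(k_p)}|_{V_{k_0} ∩ ⋯ ∩ V_{k_p}})`. -/
def cechDoubleRefine (S : CochainComplex (TopCat.Sheaf AddCommGrpCat.{u} X) ℕ)
    (τ : κ → ι) (hτ : ∀ k, V k ≤ U (τ k)) : cechDouble U S ⟶ cechDouble V S where
  f p q := AddCommGrpCat.ofHom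
    { toFun := fun (s : Cochain U (S.X q) p) i =>
        res (S.X q) (inter_le_inter τ hτ i) (s (τ ∘ i))
      map_zero' := by funext i; exact map_zero _
      map_add' := fun s t => by funext i; exact map_add _ _ _ }
  comm_δ p q := by
    ext s : 2
    funext i
    change coboundary V (S.X q) p _ i = res _ _ (coboundary U (S.X q) p s (τ ∘ i))
    simp only [coboundary, AddMonoidHom.coe_mk, ZeroHom.coe_mk, map_sum, map_zsmul, res_res]
    exact Finset.sum_congr rfl fun j _ => congrArg _ (res_res _ _ _ _)
  comm_d p q := by
    ext s : 2
    funext i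
    exact app_res (S.d q (q + 1)) _ _

end Cech

/-! ### Open coverings and Čech hypercohomology -/

/-- An open covering of `X`, given as a set of open subsets. -/
structure OpenCover (X : TopCat.{u}) where
  sets : Set (Opens X)
  exists_mem (x : X) : ∃ U ∈ sets, x ∈ U

namespace OpenCover

variable {X : TopCat.{u}}

/-- The members of a covering, indexed by themselves. -/
def family (𝒰 : OpenCover X) (i : 𝒰.sets) : Opens X := i.1

lemma exists_family (𝒰 : OpenCover X) (x : X) : ∃ i, x ∈ 𝒰.family i := by
  obtain ⟨U, hU, hx⟩ := 𝒰.exists_mem x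
  exact ⟨⟨U, hU⟩, hx⟩

/-- A refinement `𝒱 ⟶ 𝒰`: a map `τ` assigning to every member `V` of `𝒱` a member `τ(V)` of `𝒰`
such that `V ⊆ τ(V)`. -/
@[ext]
structure Refinement (𝒱 𝒰 : OpenCover X) where
  τ : 𝒱.sets → 𝒰.sets
  le_τ (V : 𝒱.sets) : 𝒱.family V ≤ 𝒰.family (τ V)

instance : SmallCategory (OpenCover X) where
  Hom 𝒱 𝒰 := Refinement 𝒱 𝒰
  id 𝒰 := ⟨id, fun _ => le_rfl⟩
  comp f g := ⟨g.τ ∘ f.τ, fun V => (f.le_τ V).trans (g.le_τ _)⟩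

end OpenCover

section Hyper

variable {X : TopCat.{u}}

/-- The total Čech complexes `C^·(𝒰, S^·)_tot`, as a functor in the covering `𝒰`. -/
def cechTotal (S : CochainComplex (TopCat.Sheaf AddCommGrpCat.{u} X) ℕ) :
    (OpenCover X)ᵒᵖ ⥤ CochainComplex AddCommGrpCat.{u} ℕ where
  obj 𝒰 := (cechDouble 𝒰.unop.family S).total
  map f := DoubleComplex.totalFunctor.map (cechDoubleRefine S f.unop.τ f.unop.le_τ)
  map_id 𝒰 := by
    ext n z : 3
    funext ⟨⟨p, q⟩, h⟩
    funext i
    exact res_self _ _ _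
  map_comp f g := by
    ext n z : 3
    funext ⟨⟨p, q⟩, h⟩
    funext i
    exact (res_res _ _ _ _).symm

/-- The functor `𝒰 ↦ ℍ^k(𝒰, S^·)`. -/
def coverHyper (S : CochainComplex (TopCat.Sheaf AddCommGrpCat.{u} X) ℕ) (k : ℕ) :
    (OpenCover X)ᵒᵖ ⥤ AddCommGrpCat.{u} :=
  cechTotal S ⋙ HomologicalComplex.homologyFunctor _ _ k

/-- Functoriality of the total Čech complexes in the complex of sheaves. -/
def cechTotalMap {S T : CochainComplex (TopCat.Sheaf AddCommGrpCat.{u} X) ℕ} (φ : S ⟶ T) :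
    cechTotal S ⟶ cechTotal T where
  app 𝒰 := DoubleComplex.totalFunctor.map (cechDoubleMap 𝒰.unop.family φ)
  naturality 𝒰 𝒱 f := by
    ext n z : 3
    funext ⟨⟨p, q⟩, h⟩
    funext i
    exact app_res (φ.f q) _ _

/-- The maps `ℍ^k(𝒰, S^·) ⟶ ℍ^k(𝒰, T^·)` induced by a morphism `S^· ⟶ T^·`. -/
def coverHyperMap {S T : CochainComplex (TopCat.Sheaf AddCommGrpCat.{u} X) ℕ} (φ : S ⟶ T) (k : ℕ) :
    coverHyper S k ⟶ coverHyper T k :=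
  Functor.whiskerRight (cechTotalMap φ) (HomologicalComplex.homologyFunctor _ _ k)

/-- Čech hypercohomology: the colimit of `ℍ^k(𝒰, S^·)` over all open coverings `𝒰` and all
refinements. (Two refinement maps `𝒱 ⟶ 𝒰` induce the same map in cohomology, so this is the
direct limit over the coverings preordered by refinement.) -/
def cechHyper (S : CochainComplex (TopCat.Sheaf AddCommGrpCat.{u} X) ℕ) (k : ℕ) :
    AddCommGrpCat.{u} :=
  colimit (coverHyper S k)

/-- The global sections functor on abelian sheaves. -/
abbrev globalSections (X : TopCat.{u}) :
    TopCat.Sheaf AddCommGrpCat.{u} X ⥤ AddCommGrpCat.{u} :=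
  (sheafSections (Opens.grothendieckTopology X) AddCommGrpCat.{u}).obj (op ⊤)

instance : (globalSections X).Additive where

end Hyper

lemma isIso_homologyMap_of_elements {K L : CochainComplex AddCommGrpCat.{u} ℕ} (f : K ⟶ L) (k : ℕ)
    (hs : ∀ z : L.X k, L.d k (k + 1) z = 0 →
      ∃ x : K.X k, K.d k (k + 1) x = 0 ∧ ∃ (j : ℕ) (y : L.X j), z - f.f k x = L.d j k y)
    (hi : ∀ x : K.X k, K.d k (k + 1) x = 0 → ∀ (j : ℕ) (y : L.X j), f.f k x = L.d j k y →
      ∃ (j : ℕ) (y : K.X j), x = K.d j k y) :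
    IsIso (HomologicalComplex.homologyMap f k) := by
  have hπ : ∀ (M : CochainComplex AddCommGrpCat.{u} ℕ),
      Function.Surjective (M.homologyπ k) := fun M =>
    (AddCommGrpCat.epi_iff_surjective _).1 inferInstance
  have hc : ∀ (M : CochainComplex AddCommGrpCat.{u} ℕ),
      Function.Injective (M.iCycles k) := fun M =>
    (AddCommGrpCat.mono_iff_injective _).1 inferInstance
  have hd : ∀ (M : CochainComplex AddCommGrpCat.{u} ℕ) (c : M.cycles k),
      M.d k (k + 1) (M.iCycles k c) = 0 := fun M c => by
    rw [← ConcreteCategory.comp_apply, HomologicalComplex.iCycles_d]; rfl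
  have hb : ∀ (M : CochainComplex AddCommGrpCat.{u} ℕ) (c : M.cycles k),
      M.homologyπ k c = 0 ↔ ∃ (j : ℕ) (y : M.X j), M.iCycles k c = M.d j k y := by
    intro M c
    constructor
    · intro h
      have := (ShortComplex.ab_exact_iff _).1 (ShortComplex.exact_of_g_is_cokernel
        (ShortComplex.mk _ _ (M.toCycles_comp_homologyπ _ k)) (M.homologyIsCokernel _ k rfl)) c h
      obtain ⟨y, hy⟩ := this
      refine ⟨_, y, ?_⟩
      rw [← hy]
      change (M.iCycles k) (M.toCycles _ k y) = _
      rw [← ConcreteCategory.comp_apply, HomologicalComplex.toCycles_i]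
    · rintro ⟨j, y, hy⟩
      have : c = M.toCycles j k y := by
        apply hc
        rw [hy, ← ConcreteCategory.comp_apply, HomologicalComplex.toCycles_i]
      rw [this, ← ConcreteCategory.comp_apply, HomologicalComplex.toCycles_comp_homologyπ]
      rfl
  have hmk : ∀ (M : CochainComplex AddCommGrpCat.{u} ℕ) (x : M.X k), M.d k (k + 1) x = 0 →
      ∃ c : M.cycles k, M.iCycles k c = x := fun M x hx =>
    (ShortComplex.ab_exact_iff _).1 (ShortComplex.exact_of_f_is_kernel
      (ShortComplex.mk _ _ (M.iCycles_d k (k + 1))) (M.cyclesIsKernel k (k + 1) (by simp))) x hx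
  have hf : ∀ c : K.cycles k, L.iCycles k (HomologicalComplex.cyclesMap f k c) =
      f.f k (K.iCycles k c) := fun c => by
    rw [← ConcreteCategory.comp_apply, HomologicalComplex.cyclesMap_i,
      ConcreteCategory.comp_apply]
  have hfπ : ∀ c : K.cycles k, HomologicalComplex.homologyMap f k (K.homologyπ k c) =
      L.homologyπ k (HomologicalComplex.cyclesMap f k c) := fun c => by
    rw [← ConcreteCategory.comp_apply, HomologicalComplex.homologyπ_naturality,
      ConcreteCategory.comp_apply]
  have : Mono (HomologicalComplex.homologyMap f k) := by
    rw [AddCommGrpCat.mono_iff_injective, injective_iff_map_eq_zero]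
    intro a ha
    obtain ⟨c, rfl⟩ := hπ K a
    rw [hfπ, hb, hf] at ha
    obtain ⟨j, y, hy⟩ := ha
    rw [hb]
    exact hi _ (hd K c) j y hy
  have : Epi (HomologicalComplex.homologyMap f k) := by
    rw [AddCommGrpCat.epi_iff_surjective]
    intro a
    obtain ⟨c, rfl⟩ := hπ L a
    obtain ⟨x, hx, j, y, hy⟩ := hs _ (hd L c)
    obtain ⟨e, rfl⟩ := hmk K x hx
    refine ⟨K.homologyπ k e, ?_⟩
    rw [hfπ, eq_comm, ← sub_eq_zero, ← map_sub, hb]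
    exact ⟨j, y, by rw [map_sub, hf, hy]⟩
  exact isIso_of_mono_of_epi _

/-- Staircase argument: if the rows of `K` are exact in positive degrees, then a total cochain
whose coboundary is concentrated in `p = 0` is, up to a total coboundary, concentrated in `p = 0`. -/
lemma DoubleComplex.exists_sub_totD (K : DoubleComplex.{u})
    (hK : ∀ (p q : ℕ) (z : K.X (p + 1) q), K.δ (p + 1) q z = 0 → ∃ w, K.δ p q w = z)
    {n : ℕ} (z : K.Tot (n + 1))
    (hz : ∀ p q h, K.totD (n + 1) z ⟨(p + 1, q), h⟩ = 0) :
    ∃ b : K.Tot n, ∀ p q h, (z - K.totD n b) ⟨(p + 1, q), h⟩ = 0 := by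
  suffices H : ∀ (m : ℕ) (z : K.Tot (n + 1)),
      (∀ p q h, K.totD (n + 1) z ⟨(p + 1, q), h⟩ = 0) →
      (∀ p q h, m < p → z ⟨(p, q), h⟩ = 0) →
      ∃ b : K.Tot n, ∀ p q h, (z - K.totD n b) ⟨(p + 1, q), h⟩ = 0 from
    H (n + 1) z hz (fun p q h hp => by dsimp only at h; omega)
  intro m
  induction m with
  | zero =>
    intro z _ hz'
    exact ⟨0, fun p q h => by simpa using hz' (p + 1) q h (by omega)⟩
  | succ m ih =>
    intro z hz hz'
    by_cases hm : m ≤ n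
    · obtain ⟨q, rfl⟩ := Nat.exists_eq_add_of_le hm
      have hcoc : K.δ (m + 1) q (z ⟨(m + 1, q), by dsimp only; omega⟩) = 0 := by
        have h1 := hz (m + 1) q (by dsimp only; omega)
        rw [K.totD_apply] at h1
        have h2 : K.totd z ⟨(m + 1 + 1, q), by dsimp only; omega⟩ = 0 := by
          rcases q with _ | q
          · rfl
          · simp only [DoubleComplex.totd]
            rw [hz' (m + 1 + 1) q _ (by omega)]
            simp
        rw [h2, add_zero] at h1
        exact h1
      obtain ⟨w, hw⟩ := hK m q _ hcoc
      let b : K.Tot (m + q) := Pi.single (M := fun a : {a : ℕ × ℕ // a.1 + a.2 = m + q} =>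
        (K.X a.1.1 a.1.2 : Type u)) ⟨(m, q), rfl⟩ w
      have hb : ∀ p' q' h', p' ≠ m → b ⟨(p', q'), h'⟩ = 0 := fun p' q' h' hp =>
        Pi.single_eq_of_ne (M := fun a : {a : ℕ × ℕ // a.1 + a.2 = m + q} =>
          (K.X a.1.1 a.1.2 : Type u)) (i := ⟨(m, q), rfl⟩) (i' := ⟨(p', q'), h'⟩) (by simp [hp]) w
      obtain ⟨b', hb'⟩ := ih (z - K.totD _ b)
        (fun p q h => by rw [map_sub, K.totD_totD, sub_zero]; exact hz p q h)
        (fun p' q' h' hp => by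
          have hd : K.totd b ⟨(p', q'), h'⟩ = 0 := by
            rcases q' with _ | q'
            · rfl
            · simp only [DoubleComplex.totd]
              rw [hb p' q' _ (by omega)]
              simp
          rw [Pi.sub_apply, K.totD_apply, hd, add_zero]
          rcases p' with _ | p'
          · omega
          · by_cases hpm : p' = m
            · subst hpm
              obtain rfl : q' = q := by dsimp only at h'; omega
              have : b ⟨(p', q'), rfl⟩ = w :=
                Pi.single_eq_same (M := fun a : {a : ℕ × ℕ // a.1 + a.2 = p' + q'} =>
                  (K.X a.1.1 a.1.2 : Type u)) ⟨(p', q'), rfl⟩ w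
              simp only [DoubleComplex.totδ]
              rw [this, hw, sub_self]
            · simp only [DoubleComplex.totδ]
              rw [hb p' q' _ hpm, hz' _ _ _ (by omega)]
              simp)
      refine ⟨b + b', fun p q h => ?_⟩
      rw [map_add, ← sub_sub]
      exact hb' p q h
    · exact ih z hz (fun p q h hp => by dsimp only at h; omega)

section Contraction

variable {X : TopCat.{u}}

/-- The sheaf of not necessarily continuous sections `U ↦ ∏_{x ∈ U} F_x`. -/
def godement (F : TopCat.Sheaf AddCommGrpCat.{u} X) : TopCat.Sheaf AddCommGrpCat.{u} X where
  obj :=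
    { obj := fun U => AddCommGrpCat.of (∀ x : U.unop, F.presheaf.stalk x.1)
      map := fun {U V} i => AddCommGrpCat.ofHom
        { toFun := fun s x => s ⟨x.1, i.unop.le x.2⟩
          map_zero' := rfl
          map_add' := fun _ _ => rfl } }
  property := by
    refine (TopCat.Presheaf.isSheaf_iff_isSheaf_comp' (forget AddCommGrpCat.{u}) _).2 ?_
    exact TopCat.Presheaf.toTypes_isSheaf X (fun x => F.presheaf.stalk x)

/-- The embedding of a sheaf in its Godement sheaf, given by the germs of a section. -/
def toGodement (F : TopCat.Sheaf AddCommGrpCat.{u} X) : F ⟶ godement F where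
  hom :=
    { app := fun U => AddCommGrpCat.ofHom
        { toFun := fun s x => F.presheaf.germ U.unop x.1 x.2 s
          map_zero' := by funext x; exact map_zero _
          map_add' := fun s t => by funext x; exact map_add _ _ _ }
      naturality := fun {U V} i => by
        ext s : 2
        funext x
        exact F.presheaf.germ_res_apply i.unop x.1 x.2 s }

instance (F : TopCat.Sheaf AddCommGrpCat.{u} X) : Mono (toGodement F) := by
  refine CategoryTheory.Sheaf.mono_of_injective _ fun U s t h => ?_
  refine TopCat.Presheaf.section_ext F U.unop s t fun x hx => ?_
  exact congrFun h ⟨x, hx⟩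

variable {ι : Type u} (U : ι → Opens X)

/-- The map `F(X) → C^0(U, F)` given by restriction. -/
def augZero (F : TopCat.Sheaf AddCommGrpCat.{u} X) :
    F.presheaf.obj (op (⊤ : Opens X)) →+ Cochain U F 0 where
  toFun s i := res F le_top s
  map_zero' := by funext i; exact map_zero _
  map_add' s t := by funext i; exact map_add _ _ _

lemma cochainMap_augZero {F G : TopCat.Sheaf AddCommGrpCat.{u} X} (φ : F ⟶ G)
    (s : F.presheaf.obj (op (⊤ : Opens X))) :
    cochainMap U φ 0 (augZero U F s) = augZero U G (app φ ⊤ s) := by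
  funext i
  exact app_res φ _ s

lemma coboundary_augZero (F : TopCat.Sheaf AddCommGrpCat.{u} X)
    (s : F.presheaf.obj (op (⊤ : Opens X))) : coboundary U F 0 (augZero U F s) = 0 := by
  funext i
  change ∑ j : Fin 2, ((-1 : ℤ) ^ (j : ℕ)) •
    res F (inter_le_comp U i j.succAbove) (res F le_top s) = 0
  rw [Fin.sum_univ_two, res_res, res_res]
  simp

variable {U}

/-- The value at `x` of a component of a Čech cochain of the Godement sheaf. -/
def gval {F : TopCat.Sheaf AddCommGrpCat.{u} X} {p : ℕ} (s : Cochain U (godement F) p)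
    (i : Fin (p + 1) → ι) (x : X) (hx : x ∈ inter U i) : F.presheaf.stalk x :=
  (show ∀ y : inter U i, F.presheaf.stalk y.1 from s i) ⟨x, hx⟩

lemma gval_congr {F : TopCat.Sheaf AddCommGrpCat.{u} X} {p : ℕ} (s : Cochain U (godement F) p)
    {i j : Fin (p + 1) → ι} (h : i = j) (x : X) (hx : x ∈ inter U i) (hx' : x ∈ inter U j) :
    gval s i x hx = gval s j x hx' := by
  subst h
  rfl

lemma gval_ext {F : TopCat.Sheaf AddCommGrpCat.{u} X} {p : ℕ} {s t : Cochain U (godement F) p}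
    (h : ∀ i x hx, gval s i x hx = gval t i x hx) : s = t := by
  funext i
  exact funext fun x : inter U i => h i x.1 x.2

lemma gval_coboundary {F : TopCat.Sheaf AddCommGrpCat.{u} X} {p : ℕ}
    (s : Cochain U (godement F) p) (i : Fin (p + 2) → ι) (x : X) (hx : x ∈ inter U i) :
    gval (coboundary U (godement F) p s) i x hx = ∑ j : Fin (p + 2),
      ((-1 : ℤ) ^ (j : ℕ)) • gval s (i ∘ j.succAbove) x (inter_le_comp U i j.succAbove hx) := by
  let ev : (godement F).presheaf.obj (op (inter U i)) →+ F.presheaf.stalk x :=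
    { toFun := fun t => (show ∀ y : inter U i, F.presheaf.stalk y.1 from t) ⟨x, hx⟩
      map_zero' := rfl
      map_add' := fun _ _ => rfl }
  change ev (∑ j : Fin (p + 2), _) = _
  rw [map_sum]
  rfl

lemma mem_inter_cons {p : ℕ} {i : Fin (p + 1) → ι} {x : X} (hx : x ∈ inter U i) {c : ι}
    (hc : x ∈ U c) : x ∈ inter U (Fin.cons c i : Fin (p + 2) → ι) := by
  rw [mem_inter]
  intro a
  refine Fin.cases ?_ (fun b => ?_) a
  · exact hc
  · exact (mem_inter U).1 hx b

lemma godement_exact (F : TopCat.Sheaf AddCommGrpCat.{u} X) (hU : ∀ x, ∃ i, x ∈ U i) (p : ℕ)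
    (s : Cochain U (godement F) (p + 1)) (hs : coboundary U _ _ s = 0) :
    ∃ t, coboundary U (godement F) p t = s := by
  choose c hc using hU
  let t : Cochain U (godement F) p := fun i =>
    (show ∀ x : inter U i, F.presheaf.stalk x.1 from
      fun x => gval s (Fin.cons (c x.1) i) x.1 (mem_inter_cons x.2 (hc x.1)))
  refine ⟨t, gval_ext fun i x hx => ?_⟩
  have h1 := gval_coboundary s (Fin.cons (c x) i) x (mem_inter_cons hx (hc x))
  rw [hs, Fin.sum_univ_succ] at h1
  change 0 = _ at h1
  rw [gval_coboundary, ← sub_eq_zero, ← neg_eq_zero, h1, neg_sub, sub_eq_add_neg,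
    ← Finset.sum_neg_distrib]
  congr 1
  · simp only [Fin.val_zero, pow_zero, one_smul]
    exact gval_congr s (by funext a; simp) x _ _
  · refine Finset.sum_congr rfl fun j _ => ?_
    rw [Fin.val_succ, pow_succ, mul_neg_one, neg_smul]
    congr 2
    refine gval_congr s ?_ x _ _
    funext a
    refine Fin.cases ?_ (fun b => ?_) a <;> simp

lemma godement_exact_zero (F : TopCat.Sheaf AddCommGrpCat.{u} X) (hU : ∀ x, ∃ i, x ∈ U i)
    (s : Cochain U (godement F) 0) (hs : coboundary U _ _ s = 0) :
    ∃ t, augZero U (godement F) t = s := by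
  choose c hc using hU
  have hmem : ∀ x, x ∈ inter U (fun _ : Fin 1 => c x) := fun x => (mem_inter U).2 fun _ => hc x
  refine ⟨(show ∀ x : (⊤ : Opens X), F.presheaf.stalk x.1 from
    fun x => gval s (fun _ => c x.1) x.1 (hmem x.1)), gval_ext fun i x hx => ?_⟩
  change gval s _ x _ = _
  have hx' : x ∈ inter U (Fin.cons (c x) i : Fin 2 → ι) := mem_inter_cons hx (hc x)
  have h1 := gval_coboundary s (Fin.cons (c x) i) x hx'
  rw [hs, Fin.sum_univ_two] at h1
  change 0 = _ at h1
  simp only [Fin.val_zero, pow_zero, one_smul, Fin.val_one, pow_one, neg_smul] at h1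
  rw [← sub_eq_add_neg, eq_comm, sub_eq_zero] at h1
  refine Eq.trans (gval_congr s ?_ x _ _) (h1.symm.trans (gval_congr s ?_ x _ _))
  · funext a
    fin_cases a
    rfl
  · funext a
    fin_cases a
    rfl

lemma augZero_injective (F : TopCat.Sheaf AddCommGrpCat.{u} X) (hU : ∀ x, ∃ i, x ∈ U i) : Function.Injective (augZero U F) := by
  intro s t h
  refine TopCat.Presheaf.section_ext F ⊤ s t fun x _ => ?_
  obtain ⟨i, hi⟩ := hU x
  have hx : x ∈ inter U (fun _ : Fin 1 => i) := (mem_inter U).2 fun _ => hi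
  have := congrArg (F.presheaf.germ _ x hx) (congrFun h fun _ => i)
  rw [← F.presheaf.germ_res_apply (homOfLE le_top) x hx s,
    ← F.presheaf.germ_res_apply (homOfLE le_top) x hx t]
  exact this

variable (F : TopCat.Sheaf AddCommGrpCat.{u} X) [Injective F]

/-- A retraction of the embedding of an injective sheaf in its Godement sheaf. -/
def godementRetract : godement F ⟶ F := Injective.factorThru (𝟙 F) (toGodement F)

lemma app_retract (V : Opens X) (s : F.presheaf.obj (op V)) :
    app (godementRetract F) V (app (toGodement F) V s) = s :=
  ConcreteCategory.congr_hom (congrArg (fun φ : F ⟶ F => φ.hom.app (op V))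
    (Injective.comp_factorThru (𝟙 F) (toGodement F))) s

lemma cochainMap_retract (p : ℕ) (s : Cochain U F p) :
    cochainMap U (godementRetract F) p (cochainMap U (toGodement F) p s) = s := by
  funext i
  exact app_retract F _ _

lemma injective_exact (hU : ∀ x, ∃ i, x ∈ U i) (p : ℕ)
    (s : Cochain U F (p + 1)) (hs : coboundary U _ _ s = 0) :
    ∃ t, coboundary U F p t = s := by
  obtain ⟨t, ht⟩ := godement_exact F hU p (cochainMap U (toGodement F) _ s)
    (by rw [coboundary_cochainMap, hs, map_zero])
  exact ⟨cochainMap U (godementRetract F) p t, by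
    rw [coboundary_cochainMap, ht, cochainMap_retract]⟩

lemma injective_exact_zero (hU : ∀ x, ∃ i, x ∈ U i)
    (s : Cochain U F 0) (hs : coboundary U _ _ s = 0) :
    ∃ t, augZero U F t = s := by
  obtain ⟨t, ht⟩ := godement_exact_zero F hU (cochainMap U (toGodement F) _ s)
    (by rw [coboundary_cochainMap, hs, map_zero])
  exact ⟨app (godementRetract F) ⊤ t, by
    rw [← cochainMap_augZero, ht, cochainMap_retract]⟩

end Contraction

section Comparison

variable {X : TopCat.{u}}

/-- The complex of global sections `Γ(X, S^·)`. -/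
abbrev Γ (S : CochainComplex (TopCat.Sheaf AddCommGrpCat.{u} X) ℕ) :
    CochainComplex AddCommGrpCat.{u} ℕ :=
  ((globalSections X).mapHomologicalComplex _).obj S

variable {ι : Type u} (U : ι → Opens X) (S : CochainComplex (TopCat.Sheaf AddCommGrpCat.{u} X) ℕ)

/-- The augmentation `Γ(X, S^n) → C^0(U, S^n) ⊆ C^·(U, S^·)_tot^n` in degree `n`, given by
restriction. -/
def augHom (n : ℕ) : (S.X n).presheaf.obj (op (⊤ : Opens X)) →+ (cechDouble U S).Tot n where
  toFun s
    | ⟨(0, q), h⟩ => augZero U (S.X q)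
        (app (S.XIsoOfEq (show n = q by dsimp only at h; omega)).hom ⊤ s)
    | ⟨(_ + 1, _), _⟩ => 0
  map_zero' := by
    funext ⟨⟨p, q⟩, h⟩
    rcases p with _ | p
    · exact (congrArg _ (map_zero _)).trans (map_zero _)
    · rfl
  map_add' s t := by
    funext ⟨⟨p, q⟩, h⟩
    rcases p with _ | p
    · exact (congrArg _ (map_add _ _ _)).trans (map_add _ _ _)
    · exact (add_zero _).symm

lemma augHom_zero (n : ℕ) (s : (S.X n).presheaf.obj (op (⊤ : Opens X))) (h : (0, n).1 + (0, n).2 = n) :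
    augHom U S n s ⟨(0, n), h⟩ = augZero U (S.X n) s := by
  change augZero U (S.X n) (app (S.XIsoOfEq rfl).hom ⊤ s) = _
  rw [HomologicalComplex.XIsoOfEq_rfl]
  rfl

lemma augHom_succ (n : ℕ) (s : (S.X n).presheaf.obj (op (⊤ : Opens X))) (p q : ℕ)
    (h : (p + 1, q).1 + (p + 1, q).2 = n) : augHom U S n s ⟨(p + 1, q), h⟩ = 0 := rfl

lemma totD_augHom (n : ℕ) (s : (S.X n).presheaf.obj (op (⊤ : Opens X))) :
    (cechDouble U S).totD n (augHom U S n s) =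
      augHom U S (n + 1) (app (S.d n (n + 1)) ⊤ s) := by
  funext ⟨⟨p, q⟩, h⟩
  rw [DoubleComplex.totD_apply]
  rcases p with _ | p
  · obtain rfl : q = n + 1 := by dsimp only at h; omega
    rw [augHom_zero]
    simp only [DoubleComplex.totδ, DoubleComplex.totd, zero_add, pow_zero, one_smul]
    rw [augHom_zero]
    exact cochainMap_augZero U _ s
  · rw [augHom_succ]
    have h2 : (cechDouble U S).totd (augHom U S n s) ⟨(p + 1, q), h⟩ = 0 := by
      rcases q with _ | q
      · rfl
      · simp only [DoubleComplex.totd]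
        rw [augHom_succ]
        simp
    rw [h2, add_zero]
    simp only [DoubleComplex.totδ]
    rcases p with _ | p
    · obtain rfl : q = n := by dsimp only at h; omega
      rw [augHom_zero]
      exact coboundary_augZero U _ s
    · rw [augHom_succ]
      simp

/-- The augmentation `Γ(X, S^·) ⟶ C^·(U, S^·)_tot`. -/
def aug : Γ S ⟶ (cechDouble U S).total where
  f n := AddCommGrpCat.ofHom (augHom U S n)
  comm' := by
    rintro n _ rfl
    rw [DoubleComplex.total_d]
    ext s : 2
    exact totD_augHom U S n s

lemma isIso_homologyMap_aug (hS : ∀ q, Injective (S.X q)) (hU : ∀ x, ∃ i, x ∈ U i) (k : ℕ) :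
    IsIso (HomologicalComplex.homologyMap (aug U S) k) := by
  have hex : ∀ (p q : ℕ) (z : (cechDouble U S).X (p + 1) q),
      (cechDouble U S).δ (p + 1) q z = 0 → ∃ w, (cechDouble U S).δ p q w = z :=
    fun p q z hz => injective_exact (S.X q) hU p z hz
  -- a total cochain concentrated in `p = 0` with coboundary concentrated in `p = 0` is global
  have key : ∀ (n : ℕ) (z : (cechDouble U S).Tot n),
      (∀ p q h, z ⟨(p + 1, q), h⟩ = 0) →
      (∀ p q h, (cechDouble U S).totD n z ⟨(p + 1, q), h⟩ = 0) →
      ∃ x, augHom U S n x = z := by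
    intro n z hz hDz
    obtain ⟨x, hx⟩ := injective_exact_zero (S.X n) hU (z ⟨(0, n), by simp⟩) (by
      have h1 := hDz 0 n (by simp; omega)
      rw [DoubleComplex.totD_apply] at h1
      have h2 : (cechDouble U S).totd z ⟨(0 + 1, n), by simp; omega⟩ = 0 := by
        rcases n with _ | n
        · rfl
        · simp only [DoubleComplex.totd]
          rw [hz]
          simp
      rw [h2, add_zero] at h1
      exact h1)
    refine ⟨x, ?_⟩
    funext ⟨⟨p, q⟩, h⟩
    rcases p with _ | p
    · obtain rfl : q = n := by dsimp only at h; omega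
      rw [augHom_zero, hx]
    · rw [augHom_succ, hz]
  have hinj : ∀ n, Function.Injective (augHom U S n) := fun n s t h => by
    refine augZero_injective (S.X n) hU ?_
    have := congrFun h ⟨(0, n), by simp⟩
    rwa [augHom_zero, augHom_zero] at this
  apply isIso_homologyMap_of_elements
  · intro (z : (cechDouble U S).Tot k) hz
    rw [DoubleComplex.total_d] at hz
    change (cechDouble U S).totD k z = 0 at hz
    obtain ⟨z', hz', j, y, hy⟩ : ∃ z' : (cechDouble U S).Tot k,
        (∀ p q h, z' ⟨(p + 1, q), h⟩ = 0) ∧ ∃ (j : ℕ) (y : (cechDouble U S).total.X j),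
          z - z' = (cechDouble U S).total.d j k y := by
      rcases k with _ | k
      · exact ⟨z, fun p q h => by dsimp only at h; omega, 0, 0,
          (sub_self z).trans (map_zero ((cechDouble U S).total.d 0 0).hom).symm⟩
      · obtain ⟨b, hb⟩ := (cechDouble U S).exists_sub_totD hex z
          (fun p q h => by rw [hz]; rfl)
        refine ⟨_, hb, k, b, ?_⟩
        rw [DoubleComplex.total_d, sub_sub_cancel]
        rfl
    have hDz' : (cechDouble U S).totD k z' = 0 := by
      have h1 : (cechDouble U S).total.d k (k + 1) ((cechDouble U S).total.d j k y) = 0 := by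
        rw [← ConcreteCategory.comp_apply, HomologicalComplex.d_comp_d]
        rfl
      rw [← hy, DoubleComplex.total_d] at h1
      change (cechDouble U S).totD k (z - z') = 0 at h1
      rwa [map_sub, hz, zero_sub, neg_eq_zero] at h1
    obtain ⟨x, hx⟩ := key k z' hz' (fun p q h => by rw [hDz']; rfl)
    refine ⟨x, ?_, j, y, ?_⟩
    · apply hinj (k + 1)
      refine Eq.trans ((totD_augHom U S k x).symm.trans ?_) (map_zero (augHom U S (k + 1))).symm
      rw [hx, hDz']
    · rw [← hy]
      exact congrArg (z - ·) hx
  · intro (x : (S.X k).presheaf.obj (op (⊤ : Opens X))) hx j y hy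
    by_cases hjk : j + 1 = k
    · subst hjk
      rw [DoubleComplex.total_d] at hy
      change augHom U S (j + 1) x = (cechDouble U S).totD j y at hy
      obtain ⟨y', hy', hD⟩ : ∃ y' : (cechDouble U S).Tot j,
          (∀ p q h, y' ⟨(p + 1, q), h⟩ = 0) ∧
            (cechDouble U S).totD j y' = (cechDouble U S).totD j y := by
        rcases j with _ | j
        · exact ⟨y, fun p q h => by dsimp only at h; omega, rfl⟩
        · obtain ⟨b, hb⟩ := (cechDouble U S).exists_sub_totD hex y
            (fun p q h => by rw [← hy]; rfl)
          refine ⟨_, hb, ?_⟩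
          refine (map_sub ((cechDouble U S).totD (j + 1)) _ _).trans ?_
          rw [DoubleComplex.totD_totD]
          exact sub_zero _
      obtain ⟨w, hw⟩ := key j y' hy' (fun p q h => by rw [hD, ← hy]; rfl)
      refine ⟨j, w, hinj _ ?_⟩
      rw [hy, ← hD, ← hw]
      exact totD_augHom U S j w
    · rw [HomologicalComplex.shape _ _ _ hjk] at hy
      have hx0 : x = 0 := hinj k (Eq.trans hy (map_zero (augHom U S k)).symm)
      exact ⟨0, 0, hx0.trans (map_zero ((Γ S).d 0 k).hom).symm⟩

variable {U} {κ : Type u} {V : κ → Opens X}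

lemma aug_refine (τ : κ → ι) (hτ : ∀ k, V k ≤ U (τ k)) :
    aug U S ≫ DoubleComplex.totalFunctor.map (cechDoubleRefine S τ hτ) = aug V S := by
  ext n s : 3
  funext ⟨⟨p, q⟩, h⟩
  rcases p with _ | p
  · funext i
    exact res_res _ _ _ _
  · funext i
    exact map_zero (res (S.X q) (inter_le_inter τ hτ i))

/-- An injective resolution of a non-negative complex `S` of abelian sheaves: a quasi-isomorphism
from `S` to a non-negative complex of injective abelian sheaves. -/
structure InjRes (S : CochainComplex (TopCat.Sheaf AddCommGrpCat.{u} X) ℕ) where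
  I : CochainComplex (TopCat.Sheaf AddCommGrpCat.{u} X) ℕ
  injective (q : ℕ) : Injective (I.X q)
  η : S ⟶ I
  quasiIso : QuasiIso η

/-- Injective resolutions exist. -/
instance : Nonempty (InjRes S) := by
  let e := ComplexShape.embeddingUpIntGE 0
  have : CochainComplex.IsStrictlyGE (S.extend e) 0 :=
    inferInstanceAs ((S.extend e).IsStrictlySupported e)
  obtain ⟨L, i, hi, hL, hL'⟩ :=
    CochainComplex.Plus.modelCategoryQuillen.exists_quasiIso_injective (S.extend e) 0
  have hlift : e.HasLift (𝟙 (L.restriction e)) := by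
    intro j hj i' hij
    have : L.d i' (e.f j) = 0 :=
      (L.isZero_X_of_isStrictlySupported e i'
        (fun k hk => hj.2 k (by rw [hk]; exact hij))).eq_of_src _ _
    rw [this]
    exact zero_comp
  let t := e.liftExtend (𝟙 (L.restriction e)) hlift
  have ht : IsIso t := by
    have : ∀ n, IsIso (t.f n) := fun n => by
      by_cases h : ∃ k, e.f k = n
      · obtain ⟨k, hk⟩ := h
        rw [e.isIso_liftExtend_f_iff _ _ hk]
        infer_instance
      · push Not at h
        exact ⟨0, (L.isZero_X_of_isStrictlySupported e n h).eq_of_src _ _,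
          (HomologicalComplex.isZero_X_of_isStrictlySupported _ e n h).eq_of_src _ _⟩
    exact HomologicalComplex.Hom.isIso_of_components t
  let φ := (e.fullyFaithfulExtendFunctor _).preimage (i ≫ t)
  have hφ : HomologicalComplex.extendMap φ e = i ≫ t :=
    (e.fullyFaithfulExtendFunctor _).map_preimage (i ≫ t)
  refine ⟨⟨L.restriction e, fun q => hL _, φ, ?_⟩⟩
  rw [← HomologicalComplex.quasiIso_extendMap_iff φ e, hφ]
  infer_instance

variable {S}

/-- Derived hypercohomology `ℍ^k(X, S^·) = H^k(Γ(X, I^·))`, computed by an injective resolution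
`I` of `S`. -/
def derivedHyper (R : InjRes S) (k : ℕ) : AddCommGrpCat.{u} := (Γ R.I).homology k

/-- For a covering `𝒰` and an injective resolution `I`, the isomorphism
`H^k(Γ(X, I^·)) ≅ ℍ^k(𝒰, I^·)` induced by the augmentation. -/
def augIso (R : InjRes S) (k : ℕ) (𝒰 : OpenCover X) :
    derivedHyper R k ≅ (coverHyper R.I k).obj (op 𝒰) :=
  @asIso _ _ _ _ (HomologicalComplex.homologyMap (aug 𝒰.family R.I) k)
    (isIso_homologyMap_aug 𝒰.family R.I R.injective 𝒰.exists_family k)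

/-- For a covering `𝒰`, the composition `ℍ^k(𝒰, S^·) ⟶ ℍ^k(𝒰, I^·) ≅ H^k(Γ(X, I^·))`. -/
def coverToDerived (R : InjRes S) (k : ℕ) (𝒰 : OpenCover X) :
    (coverHyper S k).obj (op 𝒰) ⟶ derivedHyper R k :=
  (coverHyperMap R.η k).app (op 𝒰) ≫ (augIso R k 𝒰).inv

lemma coverToDerived_refine (R : InjRes S) (k : ℕ) {𝒰 𝒱 : OpenCover X} (f : 𝒱 ⟶ 𝒰) :
    (coverHyper S k).map f.op ≫ coverToDerived R k 𝒱 = coverToDerived R k 𝒰 := by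
  have h : (augIso R k 𝒰).hom ≫ (coverHyper R.I k).map f.op = (augIso R k 𝒱).hom :=
    (HomologicalComplex.homologyMap_comp _ _ _).symm.trans
      (congrArg (HomologicalComplex.homologyMap · k) (aug_refine R.I f.τ f.le_τ))
  rw [coverToDerived, coverToDerived, NatTrans.naturality_assoc]
  congr 1
  rw [Iso.comp_inv_eq, ← h, Iso.inv_hom_id_assoc]

/-- The natural homomorphism from Čech hypercohomology to derived hypercohomology: the map induced
on the colimit by the compositions `ℍ^k(𝒰, S^·) ⟶ ℍ^k(𝒰, I^·) ≅ H^k(Γ(X, I^·))`. -/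
def cechToDerived (R : InjRes S) (k : ℕ) : cechHyper S k ⟶ derivedHyper R k :=
  colimit.desc (coverHyper S k)
    { pt := derivedHyper R k
      ι :=
        { app := fun 𝒰 => coverToDerived R k 𝒰.unop
          naturality := fun _ _ f => by
            rw [← Quiver.Hom.op_unop f, coverToDerived_refine]
            exact (Category.comp_id _).symm } }

end Comparison

end CechHyper

end

/-! Let `η : S ⟶ I` be the injective resolution. Its mapping cone S⁰ → S¹ ⊕ I⁰ → S² ⊕ I¹ → ⋯ is an
exact complex of sheaves which begins with S⁰. Taking sections is left exact, so over every open
set, and hence on the Čech cochains of every covering, the cone remains exact at its first two terms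
S⁰ and S¹ ⊕ I⁰ (`DoubleComplex.IsExactLow`). From S² ⊕ I¹ on, exactness is only local: a preimage
costs a shrinking of the open set (`exists_local_eq_d_of_quasiIso`).

On an arbitrary space a covering can be refined so that a local property holds on its members, that
is, for cochains with p = 0; on the intersections with p ≥ 1 this cannot be arranged in general. The
degrees in the theorem are those in which local exactness is needed for p = 0 only, while the
components with p ≥ 1 are supplied by left exactness.

Injectivity: if η(z) = D(y), then (z, y) is a cocycle of the total cone and z has to become a
coboundary. In degrees 0 and 1 this happens on the given covering, in degree 2 after one refinement
(`DoubleComplex.IsExactLow.exists_eq_totD_one`).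

Surjectivity: a global cocycle x of I is locally η(t) + du with dt = 0. In degree 0 the sections t
form a Čech cocycle. In degree 1 the pair (δt, -δu) lifts to a unique v in C¹(S⁰), and (t, v) is a
Čech cocycle whose image is cohomologous to x (`DoubleComplex.IsExactLow.exists_totMap_one_sub_eq`).
-/

noncomputable section

namespace CechHyper

/-! ### Cocycles, homology classes and quasi-isomorphisms of complexes of abelian groups. -/

section HomologyClass

variable {M N : CochainComplex AddCommGrpCat.{u} ℕ} {k : ℕ}

lemma exists_iCycles_eq (x : M.X k) (hx : M.d k (k + 1) x = 0) :
    ∃ c : M.cycles k, M.iCycles k c = x :=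
  (ShortComplex.ab_exact_iff _).1 (ShortComplex.exact_of_f_is_kernel
    (ShortComplex.mk _ _ (M.iCycles_d k (k + 1))) (M.cyclesIsKernel k (k + 1) (by simp))) x hx

variable (M) in
/-- The homology class of a cocycle. -/
def homologyClass (x : M.X k) (hx : M.d k (k + 1) x = 0) : M.homology k :=
  M.homologyπ k (exists_iCycles_eq x hx).choose

lemma iCycles_injective : Function.Injective (M.iCycles k) :=
  (AddCommGrpCat.mono_iff_injective _).1 inferInstance

lemma d_iCycles (c : M.cycles k) : M.d k (k + 1) (M.iCycles k c) = 0 := by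
  rw [← ConcreteCategory.comp_apply, HomologicalComplex.iCycles_d]; rfl

lemma homologyClass_iCycles (c : M.cycles k) :
    homologyClass M (M.iCycles k c) (d_iCycles c) = M.homologyπ k c :=
  congrArg (M.homologyπ k)
    (iCycles_injective (exists_iCycles_eq _ (d_iCycles c)).choose_spec)

lemma exists_homologyClass_eq (a : M.homology k) : ∃ x hx, homologyClass M (k := k) x hx = a := by
  obtain ⟨c, rfl⟩ := (AddCommGrpCat.epi_iff_surjective (M.homologyπ k)).1 inferInstance a
  exact ⟨_, d_iCycles c, homologyClass_iCycles c⟩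

/-- The index `i` is `prev k` so that degree 0 is included: there `prev 0 = 0` and the differential
`d 0 0` is zero. -/
lemma homologyClass_eq_zero_iff {i : ℕ} (hi : (ComplexShape.up ℕ).prev k = i) (x : M.X k)
    (hx : M.d k (k + 1) x = 0) : homologyClass M x hx = 0 ↔ ∃ y : M.X i, x = M.d i k y := by
  obtain ⟨c, rfl⟩ := exists_iCycles_eq x hx
  rw [homologyClass_iCycles]
  constructor
  · intro h
    obtain ⟨y, hy⟩ := (ShortComplex.ab_exact_iff _).1 (ShortComplex.exact_of_g_is_cokernel
      (ShortComplex.mk _ _ (M.toCycles_comp_homologyπ _ k)) (M.homologyIsCokernel i k hi)) c h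
    refine ⟨y, ?_⟩
    rw [← hy]
    change (M.iCycles k) (M.toCycles i k y) = _
    rw [← ConcreteCategory.comp_apply, HomologicalComplex.toCycles_i]
  · rintro ⟨y, hy⟩
    have : c = M.toCycles i k y := by
      apply iCycles_injective
      rw [hy, ← ConcreteCategory.comp_apply, HomologicalComplex.toCycles_i]
    rw [this, ← ConcreteCategory.comp_apply, HomologicalComplex.toCycles_comp_homologyπ]
    rfl

lemma homologyClass_sub (x y : M.X k) (hx : M.d k (k + 1) x = 0) (hy : M.d k (k + 1) y = 0) :
    homologyClass M (x - y) (by rw [map_sub, hx, hy, sub_zero]) =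
      homologyClass M x hx - homologyClass M y hy := by
  obtain ⟨c, rfl⟩ := exists_iCycles_eq x hx
  obtain ⟨e, rfl⟩ := exists_iCycles_eq y hy
  have := homologyClass_iCycles (c - e)
  simp only [map_sub] at this
  rw [this, homologyClass_iCycles, homologyClass_iCycles]

lemma homologyClass_eq_iff {i : ℕ} (hi : (ComplexShape.up ℕ).prev k = i) (x y : M.X k)
    (hx : M.d k (k + 1) x = 0) (hy : M.d k (k + 1) y = 0) :
    homologyClass M x hx = homologyClass M y hy ↔ ∃ w : M.X i, x - y = M.d i k w := by
  rw [← sub_eq_zero, ← homologyClass_sub, homologyClass_eq_zero_iff hi]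

lemma d_hom_f_eq_zero (f : M ⟶ N) (x : M.X k) (hx : M.d k (k + 1) x = 0) :
    N.d k (k + 1) (f.f k x) = 0 := by
  rw [← ConcreteCategory.comp_apply, f.comm, ConcreteCategory.comp_apply, hx, map_zero]

lemma homologyMap_homologyClass (f : M ⟶ N) (x : M.X k) (hx : M.d k (k + 1) x = 0) :
    HomologicalComplex.homologyMap f k (homologyClass M x hx) =
      homologyClass N (f.f k x) (d_hom_f_eq_zero f x hx) := by
  obtain ⟨c, rfl⟩ := exists_iCycles_eq x hx
  have h : f.f k (M.iCycles k c) = N.iCycles k (HomologicalComplex.cyclesMap f k c) := by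
    rw [← ConcreteCategory.comp_apply, ← HomologicalComplex.cyclesMap_i,
      ConcreteCategory.comp_apply]
  simp only [h, homologyClass_iCycles]
  rw [← ConcreteCategory.comp_apply, HomologicalComplex.homologyπ_naturality,
    ConcreteCategory.comp_apply]

lemma homologyMap_injective (f : M ⟶ N) [QuasiIso f] (k : ℕ) :
    Function.Injective (HomologicalComplex.homologyMap f k) :=
  (AddCommGrpCat.mono_iff_injective _).1 inferInstance

lemma homologyMap_surjective (f : M ⟶ N) [QuasiIso f] (k : ℕ) :
    Function.Surjective (HomologicalComplex.homologyMap f k) :=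
  (AddCommGrpCat.epi_iff_surjective _).1 inferInstance

/-- Exactness of the mapping cone at its first term: H⁰(f) is injective, and the only coboundary in
degree 0 is zero. -/
lemma eq_zero_of_quasiIso (f : M ⟶ N) [QuasiIso f] (t : M.X 0) (ht : M.d 0 1 t = 0)
    (hft : f.f 0 t = 0) : t = 0 := by
  have h : homologyClass M t ht = 0 := by
    apply homologyMap_injective f 0
    rw [homologyMap_homologyClass, map_zero, homologyClass_eq_zero_iff (i := 0) (by simp)]
    exact ⟨0, by rw [hft, map_zero]⟩
  rw [homologyClass_eq_zero_iff (i := 0) (by simp)] at h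
  obtain ⟨y, rfl⟩ := h
  rw [M.shape 0 0 (by simp)]
  rfl

/-- Elementwise exactness of the mapping cone of a quasi-isomorphism. -/
lemma exists_eq_d_of_quasiIso (f : M ⟶ N) [QuasiIso f] {i : ℕ}
    (hi : (ComplexShape.up ℕ).prev k = i) (t : M.X (k + 1)) (u : N.X k)
    (ht : M.d (k + 1) (k + 2) t = 0) (h : f.f (k + 1) t = N.d k (k + 1) u) :
    ∃ (v : M.X k) (w : N.X i), t = M.d k (k + 1) v ∧ u = f.f k v + N.d i k w := by
  have hk : (ComplexShape.up ℕ).prev (k + 1) = k := by simp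
  have h1 : homologyClass M t ht = 0 := by
    apply homologyMap_injective f (k + 1)
    rw [homologyMap_homologyClass, map_zero, homologyClass_eq_zero_iff hk]
    exact ⟨u, h⟩
  obtain ⟨v, rfl⟩ := (homologyClass_eq_zero_iff hk t ht).1 h1
  -- The cocycle u - f(v) is, by surjectivity of H^k(f), cohomologous to f(v') for a cocycle v'.
  -- Adding v' to v does not change dv.
  have hu : N.d k (k + 1) (u - f.f k v) = 0 := by
    rw [map_sub, ← h, ← ConcreteCategory.comp_apply, ← ConcreteCategory.comp_apply, f.comm,
      sub_self]
  obtain ⟨a, ha⟩ := homologyMap_surjective f k (homologyClass N _ hu)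
  obtain ⟨v', hv', rfl⟩ := exists_homologyClass_eq a
  rw [homologyMap_homologyClass, eq_comm, homologyClass_eq_iff hi] at ha
  obtain ⟨w, hw⟩ := ha
  refine ⟨v + v', w, by rw [map_add, hv', add_zero], ?_⟩
  rw [map_add, ← hw]
  abel

end HomologyClass

/-! ### Sections of the mapping cone of a quasi-isomorphism of sheaf complexes. -/

section Local

variable {X : TopCat.{u}}

lemma exists_res_eq_of_germ_eq (F : TopCat.Sheaf AddCommGrpCat.{u} X) {U : Opens X} {x : X}
    (hx : x ∈ U) (s t : F.presheaf.obj (op U))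
    (h : F.presheaf.germ U x hx s = F.presheaf.germ U x hx t) :
    ∃ (V : Opens X) (hV : V ≤ U), x ∈ V ∧ res F hV s = res F hV t := by
  obtain ⟨V, hxV, i, j, hij⟩ := F.presheaf.germ_eq x hx hx s t h
  exact ⟨V, i.le, hxV, hij⟩

lemma germ_res_eq (F : TopCat.Sheaf AddCommGrpCat.{u} X) {U V : Opens X} (h : V ≤ U) {x : X}
    (hx : x ∈ V) (s : F.presheaf.obj (op U)) :
    F.presheaf.germ V x hx (res F h s) = F.presheaf.germ U x (h hx) s :=
  F.presheaf.germ_res_apply (homOfLE h) x hx s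

/-- The complex of stalks at `x`. -/
abbrev stalkComplex (x : X) :
    CochainComplex (TopCat.Sheaf AddCommGrpCat.{u} X) ℕ ⥤ CochainComplex AddCommGrpCat.{u} ℕ :=
  (TopCat.Sheaf.forget AddCommGrpCat.{u} X ⋙
    TopCat.Presheaf.stalkFunctor AddCommGrpCat.{u} x).mapHomologicalComplex _

lemma germ_app {F G : TopCat.Sheaf AddCommGrpCat.{u} X} (φ : F ⟶ G) {U : Opens X} {x : X}
    (hx : x ∈ U) (s : F.presheaf.obj (op U)) :
    G.presheaf.germ U x hx (app φ U s) =
      (TopCat.Presheaf.stalkFunctor AddCommGrpCat.{u} x).map φ.hom (F.presheaf.germ U x hx s) :=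
  (TopCat.Presheaf.stalkFunctor_map_germ_apply U x hx φ.hom s).symm

variable {S I : CochainComplex (TopCat.Sheaf AddCommGrpCat.{u} X) ℕ} (η : S ⟶ I) [QuasiIso η]

/-- Stalk functors on abelian sheaves are exact, so `η` is a quasi-isomorphism on stalks and every
germ of `t` vanishes. -/
lemma section_eq_zero_of_quasiIso {U : Opens X} (t : (S.X 0).presheaf.obj (op U))
    (ht : app (S.d 0 1) U t = 0) (hηt : app (η.f 0) U t = 0) : t = 0 := by
  refine TopCat.Presheaf.section_ext (S.X 0) U t 0 fun x hx => ?_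
  refine (eq_zero_of_quasiIso ((stalkComplex x).map η) ((S.X 0).presheaf.germ U x hx t) ?_ ?_).trans
    (map_zero ((S.X 0).presheaf.germ U x hx).hom).symm
  · refine (germ_app (S.d 0 1) hx t).symm.trans ?_
    rw [ht]
    exact map_zero ((S.X 1).presheaf.germ U x hx).hom
  · refine (germ_app (η.f 0) hx t).symm.trans ?_
    rw [hηt]
    exact map_zero ((I.X 0).presheaf.germ U x hx).hom

/-- Sections of the mapping cone of a quasi-isomorphism are locally exact. -/
lemma exists_local_eq_d_of_quasiIso {k i : ℕ} (hi : (ComplexShape.up ℕ).prev k = i) {U : Opens X}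
    (t : (S.X (k + 1)).presheaf.obj (op U)) (u : (I.X k).presheaf.obj (op U))
    (ht : app (S.d (k + 1) (k + 2)) U t = 0)
    (h : app (η.f (k + 1)) U t = app (I.d k (k + 1)) U u) (x : X) (hx : x ∈ U) :
    ∃ (V : Opens X) (hV : V ≤ U), x ∈ V ∧ ∃ (v : (S.X k).presheaf.obj (op V))
      (w : (I.X i).presheaf.obj (op V)), res _ hV t = app (S.d k (k + 1)) V v ∧
        res _ hV u = app (η.f k) V v + app (I.d i k) V w := by
  obtain ⟨v, w, hv, hw⟩ := exists_eq_d_of_quasiIso ((stalkComplex x).map η) hi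
    ((S.X (k + 1)).presheaf.germ U x hx t) ((I.X k).presheaf.germ U x hx u)
    (by
      refine (germ_app (S.d (k + 1) (k + 2)) hx t).symm.trans ?_
      rw [ht]
      exact map_zero ((S.X (k + 2)).presheaf.germ U x hx).hom)
    (by
      refine (germ_app (η.f (k + 1)) hx t).symm.trans ?_
      rw [h]
      exact germ_app (I.d k (k + 1)) hx u)
  -- Four successive shrinkings: two to represent the germs `v` and `w` by sections, two to turn the
  -- two equations of germs into equations of sections.
  obtain ⟨V₁, hV₁, hx₁, v, rfl⟩ := (S.X k).presheaf.exists_le_germ_eq v hx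
  obtain ⟨V₂, hV₂, hx₂, w, rfl⟩ := (I.X i).presheaf.exists_le_germ_eq w hx₁
  obtain ⟨V₃, hV₃, hx₃, h₃⟩ := exists_res_eq_of_germ_eq (S.X (k + 1)) hx₂
    (res _ (hV₂.trans hV₁) t) (app (S.d k (k + 1)) V₂ (res _ hV₂ v)) (by
      rw [germ_res_eq, germ_app, germ_res_eq]
      exact hv)
  obtain ⟨V₄, hV₄, hx₄, h₄⟩ := exists_res_eq_of_germ_eq (I.X k) hx₃
    (res _ (hV₃.trans (hV₂.trans hV₁)) u)
    (app (η.f k) V₃ (res _ (hV₃.trans hV₂) v) + app (I.d i k) V₃ (res _ hV₃ w)) (by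
      rw [map_add, germ_res_eq, germ_app, germ_app, germ_res_eq, germ_res_eq]
      exact hw)
  refine ⟨V₄, hV₄.trans (hV₃.trans (hV₂.trans hV₁)), hx₄, res _ (hV₄.trans (hV₃.trans hV₂)) v,
    res _ (hV₄.trans hV₃) w, ?_, ?_⟩
  · have := congrArg (res _ hV₄) h₃
    simpa only [← app_res, res_res] using this
  · simpa only [map_add, ← app_res, res_res] using h₄

/-- In the lowest degree no shrinking is needed: local solutions are unique by
`section_eq_zero_of_quasiIso`, so they agree on overlaps and glue. -/
lemma exists_eq_d_zero_of_quasiIso {U : Opens X}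
    (t : (S.X 1).presheaf.obj (op U)) (u : (I.X 0).presheaf.obj (op U))
    (ht : app (S.d 1 2) U t = 0) (h : app (η.f 1) U t = app (I.d 0 1) U u) :
    ∃ v : (S.X 0).presheaf.obj (op U), app (S.d 0 1) U v = t ∧ app (η.f 0) U v = u := by
  -- Since `prev 0 = 0` and `d 0 0` is zero, the term with `w` in the local solution disappears.
  have h0 : ∀ V (w : (I.X 0).presheaf.obj (op V)), app (I.d 0 0) V w = 0 := fun V w => by
    rw [I.shape 0 0 (by simp)]
    rfl
  have hloc := exists_local_eq_d_of_quasiIso η (i := 0) (by simp) t u ht h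
  choose V hV hxV v w hv hu using fun x : U => hloc x.1 x.2
  simp only [h0, add_zero] at hu
  have huniq : ∀ {W : Opens X} (a b : (S.X 0).presheaf.obj (op W)),
      app (S.d 0 1) W a = app (S.d 0 1) W b → app (η.f 0) W a = app (η.f 0) W b → a = b := by
    intro W a b h1 h2
    rw [← sub_eq_zero]
    exact section_eq_zero_of_quasiIso η _ (by rw [map_sub, h1, sub_self])
      (by rw [map_sub, h2, sub_self])
  have hcover : U ≤ iSup V := fun x hx => Opens.mem_iSup.2 ⟨⟨x, hx⟩, hxV _⟩
  obtain ⟨s, hs, -⟩ := TopCat.Sheaf.existsUnique_gluing' (S.X 0) V U (fun x => homOfLE (hV x))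
    hcover v (fun x y => by
      change res (S.X 0) inf_le_left (v x) = res (S.X 0) inf_le_right (v y)
      apply huniq <;> simp only [app_res, ← hv, ← hu, res_res])
  change ∀ x, res (S.X 0) (hV x) s = v x at hs
  refine ⟨s, ?_, ?_⟩
  · refine TopCat.Sheaf.eq_of_locally_eq' (S.X 1) V U (fun x => homOfLE (hV x)) hcover _ _ fun x => ?_
    change res (S.X 1) (hV x) _ = res (S.X 1) (hV x) t
    rw [← app_res, hs, hv]
  · refine TopCat.Sheaf.eq_of_locally_eq' (I.X 0) V U (fun x => homOfLE (hV x)) hcover _ _ fun x => ?_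
    change res (I.X 0) (hV x) _ = res (I.X 0) (hV x) u
    rw [← app_res, hs, hu]

end Local

/-! ### Diagram chases in total complexes of low degree. -/

namespace DoubleComplex

variable {K L : DoubleComplex.{u}}

/-- The total cochain of degree `0` with the given component. -/
def totZero (a : K.X 0 0) : K.Tot 0
  | ⟨(0, 0), _⟩ => a
  | ⟨(0, _ + 1), _⟩ => 0
  | ⟨(_ + 1, _), _⟩ => 0

/-- The total cochain of degree `1` with the given components. -/
def totOne (a : K.X 0 1) (b : K.X 1 0) : K.Tot 1
  | ⟨(0, 0), _⟩ => 0
  | ⟨(0, 1), _⟩ => a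
  | ⟨(0, _ + 2), _⟩ => 0
  | ⟨(1, 0), _⟩ => b
  | ⟨(1, _ + 1), _⟩ => 0
  | ⟨(_ + 2, _), _⟩ => 0

lemma tot_zero_ext {z w : K.Tot 0} (h : z ⟨(0, 0), rfl⟩ = w ⟨(0, 0), rfl⟩) : z = w := by
  funext ⟨⟨p, q⟩, hpq⟩
  obtain ⟨rfl, rfl⟩ : p = 0 ∧ q = 0 := by dsimp only at hpq; omega
  exact h

lemma tot_one_ext {z w : K.Tot 1} (h₀ : z ⟨(0, 1), rfl⟩ = w ⟨(0, 1), rfl⟩)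
    (h₁ : z ⟨(1, 0), rfl⟩ = w ⟨(1, 0), rfl⟩) : z = w := by
  funext ⟨⟨p, q⟩, hpq⟩
  obtain ⟨rfl, rfl⟩ | ⟨rfl, rfl⟩ : p = 0 ∧ q = 1 ∨ p = 1 ∧ q = 0 := by
    dsimp only at hpq; omega
  · exact h₀
  · exact h₁

lemma tot_two_ext {z w : K.Tot 2} (h₀ : z ⟨(0, 2), rfl⟩ = w ⟨(0, 2), rfl⟩)
    (h₁ : z ⟨(1, 1), rfl⟩ = w ⟨(1, 1), rfl⟩) (h₂ : z ⟨(2, 0), rfl⟩ = w ⟨(2, 0), rfl⟩) : z = w := by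
  funext ⟨⟨p, q⟩, hpq⟩
  obtain ⟨rfl, rfl⟩ | ⟨rfl, rfl⟩ | ⟨rfl, rfl⟩ :
      p = 0 ∧ q = 2 ∨ p = 1 ∧ q = 1 ∨ p = 2 ∧ q = 0 := by
    dsimp only at hpq; omega
  · exact h₀
  · exact h₁
  · exact h₂

lemma totD_zero_succ {n : ℕ} (z : K.Tot n) (q : ℕ) (h : 0 + (q + 1) = n + 1) :
    K.totD n z ⟨(0, q + 1), h⟩ = K.d 0 q (z ⟨(0, q), by dsimp only; omega⟩) := by
  simp [totD_apply, totδ, totd]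

lemma totD_succ_zero {n : ℕ} (z : K.Tot n) (p : ℕ) (h : p + 1 + 0 = n + 1) :
    K.totD n z ⟨(p + 1, 0), h⟩ = K.δ p 0 (z ⟨(p, 0), by dsimp only; omega⟩) := by
  simp [totD_apply, totδ, totd]

lemma totD_one_succ {n : ℕ} (z : K.Tot n) (q : ℕ) (h : 1 + (q + 1) = n + 1) :
    K.totD n z ⟨(1, q + 1), h⟩ = K.δ 0 (q + 1) (z ⟨(0, q + 1), by dsimp only; omega⟩) -
      K.d 1 q (z ⟨(1, q), by dsimp only; omega⟩) := by
  simp [totD_apply, totδ, totd, sub_eq_add_neg]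

lemma comm_δ_apply (φ : K ⟶ L) (p q : ℕ) (x : K.X p q) :
    L.δ p q (φ.f p q x) = φ.f (p + 1) q (K.δ p q x) :=
  ConcreteCategory.congr_hom (φ.comm_δ p q) x

lemma comm_d_apply (φ : K ⟶ L) (p q : ℕ) (x : K.X p q) :
    L.d p q (φ.f p q x) = φ.f p (q + 1) (K.d p q x) :=
  ConcreteCategory.congr_hom (φ.comm_d p q) x

/-- A morphism of double complexes whose mapping cone in the `d`-direction is exact in the two
lowest degrees. -/
structure IsExactLow (φ : K ⟶ L) : Prop where
  eq_zero (p : ℕ) (t : K.X p 0) (ht : K.d p 0 t = 0) (h : φ.f p 0 t = 0) : t = 0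
  exists_eq (p : ℕ) (t : K.X p 1) (u : L.X p 0) (ht : K.d p 1 t = 0)
    (h : φ.f p 1 t = L.d p 0 u) : ∃ v, K.d p 0 v = t ∧ φ.f p 0 v = u

namespace IsExactLow

variable {φ : K ⟶ L} (hφ : IsExactLow φ)

include hφ

lemma eq_of_eq {p : ℕ} {a b : K.X p 0} (h : K.d p 0 a = K.d p 0 b)
    (h' : φ.f p 0 a = φ.f p 0 b) : a = b := by
  rw [← sub_eq_zero]
  exact hφ.eq_zero p _ (by rw [map_sub, h, sub_self]) (by rw [map_sub, h', sub_self])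

lemma totMap_injective_on_cocycles (z : K.Tot 0) (hz : K.totD 0 z = 0) (h : totMap φ 0 z = 0) :
    z = 0 :=
  tot_zero_ext <| hφ.eq_zero 0 _
    ((totD_zero_succ z 0 rfl).symm.trans (congrFun hz ⟨(0, 1), rfl⟩))
    (congrFun h ⟨(0, 0), rfl⟩)

/-- The p = 0 part of the cone cocycle (z, y) lifts to some v. The component of z at (1, 0) must
then be δv, because both have the same images under d and φ. -/
lemma exists_eq_totD_zero (z : K.Tot 1) (hz : K.totD 1 z = 0) (y : L.Tot 0)
    (h : totMap φ 1 z = L.totD 0 y) : ∃ v, z = K.totD 0 v := by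
  have hz₀ := congrFun hz ⟨(0, 2), rfl⟩
  have hz₁ := congrFun hz ⟨(1, 1), rfl⟩
  have h₀ := congrFun h ⟨(0, 1), rfl⟩
  have h₁ := congrFun h ⟨(1, 0), rfl⟩
  rw [totD_zero_succ] at hz₀ h₀
  rw [totD_one_succ] at hz₁
  rw [totD_succ_zero] at h₁
  obtain ⟨v, hv, hv'⟩ := hφ.exists_eq 0 _ _ hz₀ h₀
  refine ⟨totZero v, tot_one_ext ?_ ?_⟩
  · rw [totD_zero_succ]
    exact hv.symm
  · rw [totD_succ_zero]
    refine hφ.eq_of_eq ?_ ?_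
    · refine (sub_eq_zero.1 hz₁).symm.trans ?_
      change _ = K.d 1 0 (K.δ 0 0 v)
      rw [comm_apply, hv]
    · refine h₁.trans ?_
      change _ = φ.f 1 0 (K.δ 0 0 v)
      rw [← comm_δ_apply, hv']

/-- The assumption `hloc` solves the cone equation for p = 0, where it lies beyond the range of left
exactness. For p = 1 the existence part of low exactness applies, and for p = 2 the uniqueness part.
-/
lemma exists_eq_totD_one (z : K.Tot 2) (hz : K.totD 2 z = 0) (y : L.Tot 1)
    (h : totMap φ 2 z = L.totD 1 y)
    (hloc : ∃ (v : K.X 0 1) (w : L.X 0 0), z ⟨(0, 2), rfl⟩ = K.d 0 1 v ∧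
      y ⟨(0, 1), rfl⟩ = φ.f 0 1 v + L.d 0 0 w) : ∃ v, z = K.totD 1 v := by
  obtain ⟨v, w, hv, hw⟩ := hloc
  have hz₁ := congrFun hz ⟨(1, 2), rfl⟩
  have hz₂ := congrFun hz ⟨(2, 1), rfl⟩
  have h₁ := congrFun h ⟨(1, 1), rfl⟩
  have h₂ := congrFun h ⟨(2, 0), rfl⟩
  rw [totD_one_succ] at hz₁ h₁
  rw [totD_succ_zero] at h₂
  have hz₂' : K.δ 1 1 (z ⟨(1, 1), rfl⟩) + K.d 2 0 (z ⟨(2, 0), rfl⟩) = 0 := by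
    simpa [totD_apply, totδ, totd] using hz₂
  change φ.f 1 1 (z ⟨(1, 1), rfl⟩) = _ at h₁
  change φ.f 2 0 (z ⟨(2, 0), rfl⟩) = _ at h₂
  -- The cochain (v, b) should have total coboundary z and image y - D(w). At (1, 1) and (1, 0) this
  -- prescribes db = δv - z and φ(b) = y - δw.
  obtain ⟨b, hb, hb'⟩ := hφ.exists_eq 1 (K.δ 0 1 v - z ⟨(1, 1), rfl⟩)
    (y ⟨(1, 0), rfl⟩ - L.δ 0 0 w) (by
      rw [map_sub, comm_apply, ← hv]
      exact hz₁)
    (by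
      rw [map_sub, h₁, hw, map_sub, ← comm_δ_apply, map_add, comm_apply]
      abel)
  refine ⟨totOne v b, tot_two_ext ?_ ?_ ?_⟩
  · rw [totD_zero_succ]
    exact hv
  · rw [totD_one_succ]
    change _ = K.δ 0 1 v - K.d 1 0 b
    rw [hb, sub_sub_cancel]
  · rw [totD_succ_zero]
    change _ = K.δ 1 0 b
    refine hφ.eq_of_eq ?_ ?_
    · rw [comm_apply, hb, map_sub, δ_δ_apply, zero_sub]
      exact eq_neg_of_add_eq_zero_right hz₂'
    · rw [← comm_δ_apply, hb', map_sub, δ_δ_apply, sub_zero]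
      exact h₂

/-- The local lifts t agree on overlaps: δt is killed by d, and by φ because δx = 0. -/
lemma exists_totMap_zero_eq (x : L.Tot 0) (hx : L.δ 0 0 (x ⟨(0, 0), rfl⟩) = 0)
    (hloc : ∃ t : K.X 0 0, K.d 0 0 t = 0 ∧ x ⟨(0, 0), rfl⟩ = φ.f 0 0 t) :
    ∃ z, K.totD 0 z = 0 ∧ totMap φ 0 z = x := by
  obtain ⟨t, ht, hxt⟩ := hloc
  refine ⟨totZero t, tot_one_ext ?_ ?_, tot_zero_ext hxt.symm⟩
  · rw [totD_zero_succ]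
    exact ht
  · rw [totD_succ_zero]
    change K.δ 0 0 t = 0
    refine hφ.eq_zero 1 _ (by rw [comm_apply, ht, map_zero]) ?_
    rw [← comm_δ_apply, ← hxt, hx]

lemma exists_totMap_one_sub_eq (x : L.Tot 1) (hx : L.δ 0 1 (x ⟨(0, 1), rfl⟩) = 0)
    (hx' : x ⟨(1, 0), rfl⟩ = 0)
    (hloc : ∃ (t : K.X 0 1) (u : L.X 0 0), K.d 0 1 t = 0 ∧
      x ⟨(0, 1), rfl⟩ = φ.f 0 1 t + L.d 0 0 u) :
    ∃ z, K.totD 1 z = 0 ∧ ∃ y, totMap φ 1 z - x = L.totD 0 y := by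
  obtain ⟨t, u, ht, htu⟩ := hloc
  rw [htu, map_add] at hx
  -- Applying δ to x = φ(t) + du gives φ(δt) = d(-δu), which makes (δt, -δu) liftable.
  obtain ⟨v, hv, hv'⟩ := hφ.exists_eq 1 (K.δ 0 1 t) (-L.δ 0 0 u)
    (by rw [comm_apply, ht, map_zero])
    (by rw [map_neg, comm_apply, ← comm_δ_apply]; exact eq_neg_of_add_eq_zero_left hx)
  -- The difference φ(t, v) - x has components -du and -δu, so it is the total coboundary of -u.
  refine ⟨totOne t v, tot_two_ext ?_ ?_ ?_, totZero (-u), tot_one_ext ?_ ?_⟩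
  · rw [totD_zero_succ]
    exact ht
  · rw [totD_one_succ]
    exact sub_eq_zero.2 hv.symm
  · rw [totD_succ_zero]
    change K.δ 1 0 v = 0
    refine hφ.eq_zero 2 _ (by rw [comm_apply, hv, δ_δ_apply]) ?_
    rw [← comm_δ_apply, hv', map_neg, δ_δ_apply, neg_zero]
  · rw [totD_zero_succ]
    change φ.f 0 1 t - x ⟨(0, 1), rfl⟩ = L.d 0 0 (-u)
    rw [htu, map_neg]
    abel
  · rw [totD_succ_zero]
    change φ.f 1 0 v - x ⟨(1, 0), rfl⟩ = L.δ 0 0 (-u)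
    rw [hx', hv', map_neg, sub_zero]

end IsExactLow

end DoubleComplex

/-! ### Coverings, refinements and colimits over coverings. -/

variable {X : TopCat.{u}}

/-- Čech cochains are products of groups of sections, and the two lowest exactness statements hold
over every open set, in particular over every intersection. -/
lemma isExactLow_cechDoubleMap {ι : Type u} (U : ι → Opens X)
    {S I : CochainComplex (TopCat.Sheaf AddCommGrpCat.{u} X) ℕ} (η : S ⟶ I) [QuasiIso η] :
    DoubleComplex.IsExactLow (cechDoubleMap U η) where
  eq_zero p t ht h := by
    funext i
    exact section_eq_zero_of_quasiIso η _ (congrFun ht i) (congrFun h i)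
  exists_eq p t u ht h := by
    choose v hv hv' using fun i =>
      exists_eq_d_zero_of_quasiIso η (t i) (u i) (congrFun ht i) (congrFun h i)
    exact ⟨v, funext hv, funext hv'⟩

namespace OpenCover

/-- A property of open sets that is inherited by smaller open sets and holds locally, holds for the
members of some open covering, and hence for their intersections. -/
lemma exists_forall_inter (P : Opens X → Prop) (hP : ∀ {V W}, W ≤ V → P V → P W)
    (hloc : ∀ x, ∃ V, x ∈ V ∧ P V) :
    ∃ 𝒱 : OpenCover X, ∀ j : Fin 1 → 𝒱.sets, P (inter 𝒱.family j) := by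
  refine ⟨⟨{V | P V}, fun x => ?_⟩, fun j => ?_⟩
  · obtain ⟨V, hx, hV⟩ := hloc x
    exact ⟨V, hV, hx⟩
  · exact hP (fun x hx => (mem_inter _).1 hx 0) (j 0).2

/-- Refinement of a covering according to a local property of its members. -/
lemma exists_refinement (𝒰 : OpenCover X)
    (P : ∀ (i : Fin 1 → 𝒰.sets) (V : Opens X), V ≤ inter 𝒰.family i → Prop)
    (hP : ∀ i {V W} (hV : V ≤ inter 𝒰.family i) (hW : W ≤ V), P i V hV → P i W (hW.trans hV))
    (hloc : ∀ i, ∀ x ∈ inter 𝒰.family i, ∃ V hV, x ∈ V ∧ P i V hV) :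
    ∃ (𝒱 : OpenCover X) (f : 𝒱 ⟶ 𝒰), ∀ j : Fin 1 → 𝒱.sets,
      P (f.τ ∘ j) (inter 𝒱.family j) (inter_le_inter f.τ f.le_τ j) := by
  -- All open sets on which the property holds relative to some member of `𝒰`; the refinement map
  -- chooses such a member.
  let 𝒱 : OpenCover X :=
    { sets := {V | ∃ (i : 𝒰.sets) (hV : V ≤ inter 𝒰.family (fun _ : Fin 1 => i)), P _ V hV}
      exists_mem := fun x => by
        obtain ⟨i, hi⟩ := 𝒰.exists_family x
        obtain ⟨V, hV, hx, h⟩ := hloc (fun _ => i) x ((mem_inter _).2 fun _ => hi)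
        exact ⟨V, ⟨i, hV, h⟩, hx⟩ }
  choose τ hτ hPτ using fun V : 𝒱.sets => V.2
  let f : 𝒱 ⟶ 𝒰 := ⟨τ, fun V x hx => (mem_inter _).1 (hτ V hx) 0⟩
  refine ⟨𝒱, f, fun j => ?_⟩
  -- `f.τ ∘ j` equals the constant function only propositionally while `P` depends on it, so the
  -- index is generalised before substituting.
  have key : ∀ (i : Fin 1 → 𝒰.sets) (h : inter 𝒱.family j ≤ inter 𝒰.family i),
      (fun _ => τ (j 0)) = i → P i _ h := by
    rintro _ h rfl
    exact hP _ (hτ (j 0)) (fun x hx => (mem_inter _).1 hx 0) (hPτ (j 0))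
  refine key _ _ (funext fun a => ?_)
  rw [Subsingleton.elim a 0]
  rfl

lemma exists_common_refinement (𝒰 𝒱 : OpenCover X) :
    ∃ 𝒲 : OpenCover X, Nonempty (𝒲 ⟶ 𝒰) ∧ Nonempty (𝒲 ⟶ 𝒱) := by
  let 𝒲 : OpenCover X :=
    { sets := {W | ∃ (i : 𝒰.sets) (j : 𝒱.sets), W ≤ 𝒰.family i ∧ W ≤ 𝒱.family j}
      exists_mem := fun x => by
        obtain ⟨i, hi⟩ := 𝒰.exists_family x
        obtain ⟨j, hj⟩ := 𝒱.exists_family x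
        exact ⟨𝒰.family i ⊓ 𝒱.family j, ⟨i, j, inf_le_left, inf_le_right⟩, hi, hj⟩ }
  choose a b ha hb using fun W : 𝒲.sets => W.2
  exact ⟨𝒲, ⟨⟨a, ha⟩⟩, ⟨⟨b, hb⟩⟩⟩

instance : Nonempty (OpenCover X) :=
  ⟨⟨Set.univ, fun _ => ⟨⊤, trivial, trivial⟩⟩⟩

/-- Every element of a colimit of abelian groups over the open coverings comes from a covering. -/
lemma exists_colimit_ι_eq (G : (OpenCover X)ᵒᵖ ⥤ AddCommGrpCat.{u}) (a : (colimit G : AddCommGrpCat.{u})) :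
    ∃ (𝒰 : OpenCover X) (b : G.obj (op 𝒰)), colimit.ι G (op 𝒰) b = a := by
  -- Parallel refinement maps need not be equalised by a further refinement, so the category of
  -- coverings is not filtered in general. Common refinements suffice to make the images of the
  -- stages a directed family.
  let H : OpenCover X → AddSubgroup (colimit G : AddCommGrpCat.{u}) :=
    fun 𝒰 => (colimit.ι G (op 𝒰)).hom.range
  have hle : ∀ {𝒰 𝒱 : OpenCover X} (f : 𝒱 ⟶ 𝒰), H 𝒰 ≤ H 𝒱 := by
    rintro 𝒰 𝒱 f _ ⟨b, rfl⟩
    exact ⟨G.map f.op b, ConcreteCategory.congr_hom (colimit.w G f.op) b⟩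
  have hdir : Directed (· ≤ ·) H := fun 𝒰 𝒱 => by
    obtain ⟨𝒲, ⟨f⟩, ⟨g⟩⟩ := exists_common_refinement 𝒰 𝒱
    exact ⟨𝒲, hle f, hle g⟩
  -- The projection modulo the sum of all images vanishes on every stage, hence on the colimit. The
  -- images therefore generate the colimit, and by directedness their sum is their union.
  have hπ : AddCommGrpCat.ofHom (QuotientAddGroup.mk' (⨆ 𝒰, H 𝒰)) = 0 := by
    refine colimit.hom_ext fun 𝒰 => ?_
    ext b
    rw [comp_zero]
    exact (QuotientAddGroup.eq_zero_iff _).2 (le_iSup H 𝒰.unop ⟨b, rfl⟩)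
  have ha : a ∈ ⨆ 𝒰, H 𝒰 :=
    (QuotientAddGroup.eq_zero_iff _).1 (ConcreteCategory.congr_hom hπ a)
  obtain ⟨𝒰, b, hb⟩ := (AddSubgroup.mem_iSup_of_directed hdir).1 ha
  exact ⟨𝒰, b, hb⟩

end OpenCover

/-! ### Injectivity and surjectivity of the comparison map. -/

section ComparisonMap

variable {S : CochainComplex (TopCat.Sheaf AddCommGrpCat.{u} X) ℕ} (R : InjRes S)

lemma cechToDerived_ι (k : ℕ) (𝒰 : OpenCover X) (a : (coverHyper S k).obj (op 𝒰)) :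
    cechToDerived R k (colimit.ι (coverHyper S k) (op 𝒰) a) = coverToDerived R k 𝒰 a :=
  ConcreteCategory.congr_hom (colimit.ι_desc _ (op 𝒰)) a

/-- Replaces the inverse of the augmentation isomorphism by the isomorphism itself, which is
explicit on cochains. -/
lemma coverToDerived_eq_iff (k : ℕ) (𝒰 : OpenCover X) (a : (coverHyper S k).obj (op 𝒰))
    (b : derivedHyper R k) :
    coverToDerived R k 𝒰 a = b ↔ (coverHyperMap R.η k).app (op 𝒰) a = (augIso R k 𝒰).hom b := by
  constructor
  · rintro rfl
    exact (ConcreteCategory.congr_hom (by simp [coverToDerived]) a :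
      ((coverHyperMap R.η k).app (op 𝒰)) a =
        (coverToDerived R k 𝒰 ≫ (augIso R k 𝒰).hom) a)
  · intro h
    refine (congrArg (augIso R k 𝒰).inv h).trans ?_
    exact ConcreteCategory.congr_hom (augIso R k 𝒰).hom_inv_id b

/-- The comparison map is injective if cocycles which become coboundaries in an injective resolution
become coboundaries on a refinement. -/
lemma cechToDerived_injective {k i : ℕ} (hi : (ComplexShape.up ℕ).prev k = i)
    (h : ∀ (𝒰 : OpenCover X) (z : (cechDouble 𝒰.family S).Tot k)
      (y : (cechDouble 𝒰.family R.I).total.X i), (cechDouble 𝒰.family S).totD k z = 0 →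
      DoubleComplex.totMap (cechDoubleMap 𝒰.family R.η) k z =
        (cechDouble 𝒰.family R.I).total.d i k y →
      ∃ (𝒱 : OpenCover X) (f : 𝒱 ⟶ 𝒰) (v : (cechDouble 𝒱.family S).total.X i),
        DoubleComplex.totMap (cechDoubleRefine S f.τ f.le_τ) k z =
          (cechDouble 𝒱.family S).total.d i k v) :
    Function.Injective (cechToDerived R k) := by
  rw [injective_iff_map_eq_zero]
  intro a ha
  obtain ⟨𝒰, a, rfl⟩ := OpenCover.exists_colimit_ι_eq _ a
  rw [cechToDerived_ι, coverToDerived_eq_iff, map_zero] at ha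
  obtain ⟨z, hz, rfl⟩ := exists_homologyClass_eq (M := (cechDouble 𝒰.family S).total) a
  have ha' := (homologyMap_homologyClass
    (DoubleComplex.totalFunctor.map (cechDoubleMap 𝒰.family R.η)) z hz).symm.trans ha
  obtain ⟨y, hy⟩ := (homologyClass_eq_zero_iff hi _ _).1 ha'
  have hz' := hz
  rw [DoubleComplex.total_d] at hz'
  obtain ⟨𝒱, f, v, hv⟩ := h 𝒰 z y hz' hy
  have h0 : (coverHyper S k).map f.op (homologyClass _ z hz) = 0 := by
    refine (homologyMap_homologyClass
      (DoubleComplex.totalFunctor.map (cechDoubleRefine S f.τ f.le_τ)) z hz).trans ?_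
    exact (homologyClass_eq_zero_iff hi _ _).2 ⟨v, hv⟩
  -- A class that dies on a refinement dies in the colimit; this direction needs only compatibility
  -- with the transition maps, not filteredness.
  refine (ConcreteCategory.congr_hom (colimit.w (coverHyper S k) f.op) _).symm.trans ?_
  exact (congrArg (colimit.ι (coverHyper S k) (op 𝒱)) h0).trans (map_zero _)

/-- The comparison map is surjective if every global cocycle of an injective resolution is
cohomologous to a Čech cocycle on some covering. -/
lemma cechToDerived_surjective {k i : ℕ} (hi : (ComplexShape.up ℕ).prev k = i)
    (h : ∀ x : (R.I.X k).presheaf.obj (op (⊤ : Opens X)), app (R.I.d k (k + 1)) ⊤ x = 0 →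
      ∃ (𝒰 : OpenCover X) (z : (cechDouble 𝒰.family S).Tot k),
        (cechDouble 𝒰.family S).totD k z = 0 ∧ ∃ y : (cechDouble 𝒰.family R.I).total.X i,
        DoubleComplex.totMap (cechDoubleMap 𝒰.family R.η) k z - augHom 𝒰.family R.I k x =
          (cechDouble 𝒰.family R.I).total.d i k y) :
    Function.Surjective (cechToDerived R k) := by
  intro b
  obtain ⟨x, hx, rfl⟩ := exists_homologyClass_eq (M := Γ R.I) b
  obtain ⟨𝒰, z, hz, y, hy⟩ := h x hx
  have hz' : (cechDouble 𝒰.family S).total.d k (k + 1) z = 0 := by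
    rw [DoubleComplex.total_d]
    exact hz
  refine ⟨colimit.ι (coverHyper S k) (op 𝒰) (homologyClass (cechDouble 𝒰.family S).total z hz'), ?_⟩
  refine (cechToDerived_ι R k 𝒰 _).trans ((coverToDerived_eq_iff R k 𝒰 _ _).2 ?_)
  refine (homologyMap_homologyClass
    (DoubleComplex.totalFunctor.map (cechDoubleMap 𝒰.family R.η)) z hz').trans
    (Eq.trans ?_ (homologyMap_homologyClass (aug 𝒰.family R.I) x hx).symm)
  exact (homologyClass_eq_iff hi _ _ _ _).2 ⟨y, hy⟩

lemma cechToDerived_zero_injective : Function.Injective (cechToDerived R 0) := by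
  have := R.quasiIso
  refine cechToDerived_injective R (i := 0) (by simp) fun 𝒰 z y hz hy => ⟨𝒰, 𝟙 _, 0, ?_⟩
  -- In degree 0 the coboundary is `d 0 0`, which is zero, so the hypothesis says that z has image
  -- zero.
  rw [HomologicalComplex.shape _ 0 0 (by simp)] at hy
  rw [(isExactLow_cechDoubleMap 𝒰.family R.η).totMap_injective_on_cocycles z hz hy]
  exact (map_zero _).trans (map_zero _).symm

/-- Each covering already gives an injective map in degree 1, so the identity serves as the
refinement. -/
lemma cechToDerived_one_injective : Function.Injective (cechToDerived R 1) := by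
  have := R.quasiIso
  refine cechToDerived_injective R (i := 0) (by simp) fun 𝒰 z y hz hy => ?_
  rw [DoubleComplex.total_d] at hy
  obtain ⟨v, rfl⟩ := (isExactLow_cechDoubleMap 𝒰.family R.η).exists_eq_totD_zero z hz y hy
  refine ⟨𝒰, 𝟙 _, DoubleComplex.totMap (cechDoubleRefine S _ (𝟙 𝒰 : 𝒰 ⟶ 𝒰).le_τ) 0 v, ?_⟩
  rw [DoubleComplex.total_d]
  exact (DoubleComplex.totD_totMap _ _ _).symm

lemma cechToDerived_two_injective : Function.Injective (cechToDerived R 2) := by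
  have := R.quasiIso
  refine cechToDerived_injective R (i := 1) (by simp) fun 𝒰 z y hz hy => ?_
  rw [DoubleComplex.total_d] at hy
  change _ = (cechDouble 𝒰.family R.I).totD 1 y at hy
  let t : Cochain 𝒰.family (S.X 2) 0 := z ⟨(0, 2), rfl⟩
  let u : Cochain 𝒰.family (R.I.X 1) 0 := y ⟨(0, 1), rfl⟩
  have ht : ∀ i, app (S.d 2 3) _ (t i) = 0 := fun i =>
    congrFun ((DoubleComplex.totD_zero_succ z 2 rfl).symm.trans (congrFun hz ⟨(0, 3), rfl⟩)) i
  have htu : ∀ i, app (R.η.f 2) _ (t i) = app (R.I.d 1 2) _ (u i) := fun i =>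
    congrFun ((congrFun hy ⟨(0, 2), rfl⟩).trans (DoubleComplex.totD_zero_succ y 1 rfl)) i
  -- The single refinement of the argument: it makes the p = 0 part (t, u) of the cone cocycle exact
  -- on the members of the covering. The components with p ≥ 1 are left to `exists_eq_totD_one`.
  obtain ⟨𝒱, f, hf⟩ := 𝒰.exists_refinement
    (fun i V hV => ∃ (v : (S.X 1).presheaf.obj (op V)) (w : (R.I.X 0).presheaf.obj (op V)),
      res _ hV (t i) = app (S.d 1 2) V v ∧
        res _ hV (u i) = app (R.η.f 1) V v + app (R.I.d 0 1) V w)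
    (by
      rintro i V W hV hW ⟨v, w, hv, hw⟩
      refine ⟨res _ hW v, res _ hW w, ?_, ?_⟩
      · rw [app_res, ← hv, res_res]
      · rw [app_res, app_res, ← map_add, ← hw, res_res])
    (fun i x hx => exists_local_eq_d_of_quasiIso R.η (by simp) (t i) (u i) (ht i) (htu i) x hx)
  choose v w hv hw using hf
  have hcomm : DoubleComplex.totMap (cechDoubleMap 𝒱.family R.η) 2
      (DoubleComplex.totMap (cechDoubleRefine S f.τ f.le_τ) 2 z) =
        DoubleComplex.totMap (cechDoubleRefine R.I f.τ f.le_τ) 2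
          (DoubleComplex.totMap (cechDoubleMap 𝒰.family R.η) 2 z) := by
    funext a i
    exact app_res (R.η.f a.1.2) _ _
  obtain ⟨b, hb⟩ := (isExactLow_cechDoubleMap 𝒱.family R.η).exists_eq_totD_one
    (DoubleComplex.totMap (cechDoubleRefine S f.τ f.le_τ) 2 z)
    (by rw [DoubleComplex.totD_totMap, hz, map_zero])
    (DoubleComplex.totMap (cechDoubleRefine R.I f.τ f.le_τ) 1 y)
    (by rw [hcomm, hy]; exact (DoubleComplex.totD_totMap _ 1 y).symm)
    ⟨v, w, funext hv, funext hw⟩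
  refine ⟨𝒱, f, b, ?_⟩
  rw [DoubleComplex.total_d]
  exact hb

lemma cechToDerived_zero_surjective : Function.Surjective (cechToDerived R 0) := by
  have := R.quasiIso
  refine cechToDerived_surjective R (i := 0) (by simp) fun x hx => ?_
  obtain ⟨𝒱, hV⟩ := OpenCover.exists_forall_inter
    (fun V : Opens X => ∃ t : (S.X 0).presheaf.obj (op V), app (S.d 0 1) V t = 0 ∧
      res (R.I.X 0) le_top x = app (R.η.f 0) V t)
    (by
      rintro V W hW ⟨t, ht, h⟩
      refine ⟨res _ hW t, ?_, ?_⟩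
      · rw [app_res, ht, map_zero]
      · rw [app_res, ← h, res_res])
    (fun p => by
      -- Local exactness is applied to the cone cocycle (0, x): the vanishing first component makes
      -- the local lift `t` a cocycle.
      obtain ⟨V, hV, hp, t, w, ht, hw⟩ := exists_local_eq_d_of_quasiIso R.η (k := 0) (i := 0)
        (by simp) (U := ⊤) 0 x (map_zero _) (by rw [map_zero, hx]) p trivial
      refine ⟨V, hp, t, ht.symm.trans (map_zero _), ?_⟩
      rw [R.I.shape 0 0 (by simp)] at hw
      exact hw.trans (add_zero _))
  choose t ht h using hV
  obtain ⟨z, hz, hzx⟩ := (isExactLow_cechDoubleMap 𝒱.family R.η).exists_totMap_zero_eq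
    (augHom 𝒱.family R.I 0 x)
    (by rw [augHom_zero]; exact coboundary_augZero 𝒱.family (R.I.X 0) x)
    ⟨t, funext ht, by rw [augHom_zero]; exact funext h⟩
  exact ⟨𝒱, z, hz, 0, by rw [hzx, sub_self, map_zero]; rfl⟩

lemma cechToDerived_one_surjective : Function.Surjective (cechToDerived R 1) := by
  have := R.quasiIso
  refine cechToDerived_surjective R (i := 0) (by simp) fun x hx => ?_
  obtain ⟨𝒱, hV⟩ := OpenCover.exists_forall_inter
    (fun V : Opens X => ∃ (t : (S.X 1).presheaf.obj (op V)) (u : (R.I.X 0).presheaf.obj (op V)),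
      app (S.d 1 2) V t = 0 ∧
        res (R.I.X 1) le_top x = app (R.η.f 1) V t + app (R.I.d 0 1) V u)
    (by
      rintro V W hW ⟨t, u, ht, h⟩
      refine ⟨res _ hW t, res _ hW u, ?_, ?_⟩
      · rw [app_res, ht, map_zero]
      · rw [app_res, app_res, ← map_add, ← h, res_res])
    (fun p => by
      -- Again (0, x) is a cocycle of the cone; in degree 1 the lift of x is only up to a coboundary
      -- du.
      obtain ⟨V, hV, hp, t, u, ht, hu⟩ := exists_local_eq_d_of_quasiIso R.η (k := 1) (i := 0)
        (by simp) (U := ⊤) 0 x (map_zero _) (by rw [map_zero, hx]) p trivial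
      exact ⟨V, hp, t, u, ht.symm.trans (map_zero _), hu⟩)
  choose t u ht h using hV
  obtain ⟨z, hz, y, hy⟩ := (isExactLow_cechDoubleMap 𝒱.family R.η).exists_totMap_one_sub_eq
    (augHom 𝒱.family R.I 1 x)
    (by rw [augHom_zero]; exact coboundary_augZero 𝒱.family (R.I.X 1) x)
    (augHom_succ 𝒱.family R.I 1 x 0 0 rfl)
    ⟨t, u, funext ht, by rw [augHom_zero]; exact funext h⟩
  refine ⟨𝒱, z, hz, y, ?_⟩
  rw [DoubleComplex.total_d]
  exact hy

end ComparisonMap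

end CechHyper

end

theorem mainTheorem12 {X : TopCat.{u}}
    (S : CochainComplex (TopCat.Sheaf AddCommGrpCat.{u} X) ℕ) (R : CechHyper.InjRes S) :
    (∀ k : ℕ, k ≤ 1 → Function.Bijective (CechHyper.cechToDerived R k)) ∧
      Function.Injective (CechHyper.cechToDerived R 2) := by
  refine ⟨fun k hk => ?_, CechHyper.cechToDerived_two_injective R⟩
  obtain rfl | rfl : k = 0 ∨ k = 1 := by omega
  · exact ⟨CechHyper.cechToDerived_zero_injective R, CechHyper.cechToDerived_zero_surjective R⟩
  · exact ⟨CechHyper.cechToDerived_one_injective R, CechHyper.cechToDerived_one_surjective R⟩
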